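/- **Conventions.** For $n\ge 0$ put $[n]=\sum_{i=0}^{n-1}q^{i}$, $[n]!=\prod_{i=1}^{n}[i]$ and $\genfrac{[}{]}{0pt}{}{n}{k_1,\ldots,k_r}=\dfrac{[n]!}{\prod_{i=1}^{r}[k_i]!}$, where $q$ is a formal variable. A *Dyck path* of length $2n$ is a lattice path from $(0,0)$ to $(2n,0)$ with steps $U=(1,1)$ and $D=(1,-1)$ that never goes below $y=0$. For Dyck paths $\lambda,\mu$ of the same length with $\mu$ weakly above $\lambda$, let $\lambda/\mu$ be the skew shape consisting of the unit boxes (squares with diagonals of length $2$ parallel to the axes and with corners at points with integer coordinates of even sum) lying between the lower path $\lambda$ and the upper path $\mu$. A *Dyck tile* is a ribbon (a skew shape containing no $2\times2$ block of boxes) such that the centers of its boxes form a Dyck path up to translation; a single box is allowed. A *Dyck tiling* of $\lambda/\mu$ is a partition of its boxes into Dyck tiles. It is *cover-inclusive* if for every tile $T$, the translate of $T$ vertically downward by one box either lies entirely below $\lambda$ or is contained in another tile of the tiling. Let $\mathcal{D}(\lambda/\mu)$ be the set of cover-inclusive Dyck tilings of $\lambda/\mu$, and let $\mathcal{D}(\lambda/\ast)=\bigcup_{\mu}\mathcal{D}(\lambda/\mu)$.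 For $D\in\mathcal{D}(\lambda/\ast)$ let $\mathrm{art}(D)=(\mathrm{area}(D)+\mathrm{tiles}(D))/2$, where $\mathrm{area}(D)$ is the number of boxes and $\mathrm{tiles}(D)$ the number of tiles of $D$. The *plane tree* $A(\lambda)$ of a Dyck word $\lambda$ is the rooted plane tree with: $A(\emptyset)$ is a single vertex; for Dyck words $z,\lambda'$, $A(z\lambda')$ is obtained by joining $A(z)$ and $A(\lambda')$ at their roots; and $A(UzD)$ is obtained by attaching an edge just above the root of $A(z)$. A *ramification point* of $A(\lambda)$ is a vertex (possibly the root) with $k\ge2$ edges $e_1,\ldots,e_k$ going down from it. Enumerate the ramification points by $i=1,\ldots,R$. For the $i$-th one, with $k=k_i$ edges $e_1,\ldots,e_k$ below it, let $M_i$ be the number of edges of the part of $A(\lambda)$ below it, and let $N_{i,j}$, $1\le j\le k$, be the number of edges of the partial tree consisting of $e_j$ and everything below $e_j$, so that $M_i=\sum_{j=1}^{k}N_{i,j}$. **Theorem.** For every Dyck path $\lambda$, $$\sum_{D\in\mathcal{D}(\lambda/\ast)}q^{\mathrm{art}(D)}=\prod_{i=1}^{R}\genfrac{[}{]}{0pt}{}{M_{i}}{N_{i,1},N_{i,2},\ldots,N_{i,k_i}}.$$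 -/

import Mathlib

namespace DyckTiling

/-! ### Dyck paths and skew shapes -/

/-- The height of a Dyck path after its first `i` steps. For `i` beyond the length of the path
this is `0`. -/
def height (w : DyckWord) (i : ℕ) : ℤ :=
  ((w.toList.take i).count DyckStep.U : ℤ) - ((w.toList.take i).count DyckStep.D : ℤ)

/-- The Dyck path `l` lies weakly below the Dyck path `m`, and both have the same length, i.e.
the skew shape with lower path `l` and upper path `m` exists. -/
def IsBelow (l m : DyckWord) : Prop :=
  l.semilength = m.semilength ∧ ∀ i, height l i ≤ height m i

/-- A box is given by the coordinates `(x, y)` of its center. It is the square with the four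
corners `(x - 1, y)`, `(x + 1, y)`, `(x, y - 1)`, `(x, y + 1)`. Vertices of Dyck paths have
even coordinate sum, so centers of boxes have odd coordinate sum. -/
abbrev Box := ℕ × ℤ

/-- The boxes between the lower path `l` and the upper path `m`: the bottom corner `(x, y - 1)` is
weakly above `l` and the top corner `(x, y + 1)` is weakly below `m`. -/
noncomputable def skewShape (l m : DyckWord) : Finset Box :=
  ((Finset.range (2 * m.semilength + 1)) ×ˢ (Finset.Icc (0 : ℤ) m.semilength)).filter fun c =>
    Odd ((c.1 : ℤ) + c.2) ∧ height l c.1 ≤ c.2 - 1 ∧ c.2 + 1 ≤ height m c.1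

/-- The ranges in the definition of `skewShape` impose no condition. -/
theorem mem_skewShape {l m : DyckWord} {c : Box} : c ∈ skewShape l m ↔
    Odd ((c.1 : ℤ) + c.2) ∧ height l c.1 ≤ c.2 - 1 ∧ c.2 + 1 ≤ height m c.1 := by
  simp only [skewShape, Finset.mem_filter, Finset.mem_product, Finset.mem_range, Finset.mem_Icc,
    and_iff_right_iff_imp]
  rintro ⟨-, h1, h2⟩
  have hl : 0 ≤ height l c.1 := by
    have := l.count_D_le_count_U c.1
    simp only [height]; omega
  have hm : height m c.1 ≤ m.semilength := by
    have : (m.toList.take c.1).count DyckStep.U ≤ m.semilength :=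
      (List.take_sublist _ _).count_le _
    simp only [height]; omega
  refine ⟨?_, by omega, by omega⟩
  by_contra hx
  have hlen : m.toList.length ≤ c.1 := by
    rw [← m.two_mul_semilength_eq_length]; omega
  have : height m c.1 = 0 := by
    simp [height, List.take_of_length_le hlen, m.count_U_eq_count_D]
  omega

/-! ### Dyck tiles and cover-inclusive Dyck tilings -/

/-- The ribbon whose box centers are the vertices of the Dyck path `p` translated to start at
the point `c`. -/
def ribbon (c : Box) (p : DyckWord) : Finset Box :=
  (Finset.range (2 * p.semilength + 1)).image fun i => (c.1 + i, c.2 + height p i)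

/-- A Dyck tile is a ribbon such that the centers of its boxes form a Dyck path (possibly of
length zero, in which case the tile is a single box). -/
def IsDyckTile (T : Finset Box) : Prop :=
  ∃ (c : Box) (p : DyckWord), T = ribbon c p

/-- The box directly below a given box. -/
def Box.down (c : Box) : Box := (c.1, c.2 - 2)

/-- The box `c` lies below the path `l`: its top corner is weakly below `l`. -/
def Box.IsUnder (l : DyckWord) (c : Box) : Prop := c.2 + 1 ≤ height l c.1

/-- `D`, a finite set of tiles, is a cover-inclusive Dyck tiling of the skew shape with lower
path `l` and upper path `m`. -/
structure IsCoverInclusive (l m : DyckWord) (D : Finset (Finset Box)) : Prop where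
  below : IsBelow l m
  isDyckTile : ∀ T ∈ D, IsDyckTile T
  disjoint : (D : Set (Finset Box)).PairwiseDisjoint id
  union_eq : D.biUnion id = skewShape l m
  coverInclusive : ∀ T ∈ D, (∀ c ∈ T, (Box.down c).IsUnder l) ∨
    ∃ T' ∈ D, T.image Box.down ⊆ T'

open Classical in
/-- The set `𝒟(l/m)` of cover-inclusive Dyck tilings with lower path `l` and upper path `m`. -/
noncomputable def tilings (l m : DyckWord) : Finset (Finset (Finset Box)) :=
  (skewShape l m).powerset.powerset.filter (IsCoverInclusive l m)

theorem mem_tilings {l m : DyckWord} {D : Finset (Finset Box)} :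
    D ∈ tilings l m ↔ IsCoverInclusive l m D := by
  simp only [tilings, Finset.mem_filter, Finset.mem_powerset, and_iff_right_iff_imp]
  intro h T hT
  rw [Finset.mem_powerset, ← h.union_eq]
  exact Finset.subset_biUnion_of_mem id hT

/-- The set `𝒟(l/∗)` of cover-inclusive Dyck tilings with lower path `l`, the union of the sets
`𝒟(l/m)` over all Dyck paths `m`. -/
noncomputable def tilingsWithLower (l : DyckWord) : Finset (Finset (Finset Box)) :=
  (Finset.univ : Finset {m : DyckWord // m.semilength = l.semilength}).biUnion
    fun m => tilings l m.1

theorem mem_tilingsWithLower {l : DyckWord} {D : Finset (Finset Box)} :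
    D ∈ tilingsWithLower l ↔ ∃ m, IsCoverInclusive l m D := by
  simp only [tilingsWithLower, Finset.mem_biUnion, Finset.mem_univ, true_and, mem_tilings]
  exact ⟨fun ⟨m, h⟩ => ⟨m.1, h⟩, fun ⟨m, h⟩ => ⟨⟨m, h.below.1.symm⟩, h⟩⟩

/-- The number of boxes of a tiling. -/
def area (D : Finset (Finset Box)) : ℕ := (D.biUnion id).card

/-- The number of tiles of a tiling. -/
def tiles (D : Finset (Finset Box)) : ℕ := D.card

/-- The statistic `art = (area + tiles) / 2`; the division is exact on Dyck tilings, see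
`two_mul_art`. -/
def art (D : Finset (Finset Box)) : ℕ := (area D + tiles D) / 2

theorem two_mul_art {l m : DyckWord} {D : Finset (Finset Box)} (h : IsCoverInclusive l m D) :
    2 * art D = area D + tiles D := by
  have hcard : ∀ T ∈ D, ∃ k, T.card + 1 = 2 * k := by
    intro T hT
    obtain ⟨c, p, rfl⟩ := h.isDyckTile T hT
    refine ⟨p.semilength + 1, ?_⟩
    rw [ribbon, Finset.card_image_of_injective, Finset.card_range]
    · ring
    · intro i j hij
      simpa using congrArg Prod.fst hij
  have hsum : area D + tiles D = ∑ T ∈ D, (T.card + 1) := by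
    rw [area, tiles, Finset.card_biUnion h.disjoint, Finset.sum_add_distrib]
    simp
  have hdvd : 2 ∣ area D + tiles D := by
    rw [hsum]
    exact Finset.dvd_sum fun T hT => (hcard T hT).imp fun _ hk => hk
  exact Nat.mul_div_cancel' hdvd

/-! ### Plane trees -/

/-- Rooted plane trees: a vertex with the ordered list of the subtrees hanging below it, one for
each edge leaving the vertex. -/
inductive PlaneTree where
  | node (children : List PlaneTree) : PlaneTree

/-- The subtrees hanging below the root, from left to right. -/
def PlaneTree.children : PlaneTree → List PlaneTree
  | .node ts => ts

/-- The number of edges of a plane tree. -/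
def PlaneTree.numEdges : PlaneTree → ℕ
  | .node ts => (ts.map fun t => t.numEdges + 1).sum

/-- The list of the subtrees rooted at the vertices of a plane tree, one for each vertex (the
root included). The subtree rooted at a vertex consists of everything below that vertex. -/
def PlaneTree.vertices : PlaneTree → List PlaneTree
  | .node ts => .node ts :: (ts.map fun t => t.vertices).flatten

/-- The ramification points of a plane tree, i.e. the vertices with at least two edges below them
(the root included), each one represented by the subtree rooted at it. -/
def PlaneTree.ramificationPoints (t : PlaneTree) : List PlaneTree :=
  t.vertices.filter fun s => 2 ≤ s.children.length

/-- The plane tree of a Dyck word: the empty word gives the tree without edges, and for Dyck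
words `z`, `w'` the tree of `U z D w'` is obtained by joining at the root the tree of `U z D`,
which is the tree of `z` with an edge attached above its root, and the tree of `w'`. -/
def planeTree (w : DyckWord) : PlaneTree :=
  if w = 0 then .node []
  else .node (planeTree w.insidePart :: (planeTree w.outsidePart).children)
termination_by w.semilength
decreasing_by
  exacts [DyckWord.semilength_insidePart_lt ‹_›, DyckWord.semilength_outsidePart_lt ‹_›]

/-! ### Quantum integers, in the field of rational functions in `q` -/

/-- The quantum integer `[n] = 1 + q + ⋯ + q ^ (n - 1)`. -/
noncomputable def qInt (n : ℕ) : RatFunc ℚ := ∑ i ∈ Finset.range n, RatFunc.X ^ i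

/-- The quantum factorial `[n]! = [1] [2] ⋯ [n]`. -/
noncomputable def qFactorial (n : ℕ) : RatFunc ℚ := ∏ i ∈ Finset.Icc 1 n, qInt i

/-- The quantum multinomial coefficient `[n]! / ([k₁]! ⋯ [kᵣ]!)`. -/
noncomputable def qMultinomial (n : ℕ) (ks : List ℕ) : RatFunc ℚ :=
  qFactorial n / (ks.map qFactorial).prod

end DyckTiling

/-! A cover-inclusive tiling is rigid. Pushing a tile down one box at a time, cover-inclusivity
forces it to meet the lower path along its whole length at once. So every tile is a vertical
translate of a stretch of the lower path, in some layer `k`, between two points of equal height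
below which the path does not drop in between (`IsCoverInclusive.exists_layerTile`). Moreover, if a
tile joins columns `x` and `x + 1` in layer `k + 1`, some tile joins them in layer `k`. Hence the
tiling is recovered from the column sizes `h x` and the numbers `l x` of joints between adjacent
columns: the tiles of layer `k` are the maximal runs of columns linked by joints with `k < l x`
(`IsCoverInclusive.exists_encodes`, `IsClosedLabelling.exists_tiling`).

In these terms the tile condition says that `l` agrees on the two steps matched by an arch of the
lower path and is at least as large on the steps under the arch (`isLabelling_iff`). Counting tiles
by their right ends gives `tiles = ∑ (h - l)`, so `art` is the sum of `h` over all columns minus the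
sum of `l` over the up steps (`art_eq_labelWeight`).

All constraints are local in the first-return decomposition, so the generating function is computed
by linear operators on functions of a column height (`transfer`, built from `plant`;
`exists_finset_isLabelling`). These operators act simply on the vectors `gaussWeight a`, whose
`i`-th entry is the coefficient of `z ^ i` in `∏ (1 + q ^ j z)` over `1 ≤ j ≤ a`: a tree with `n`
edges takes index `a` to `a + n` and multiplies by its own weight and by a Gaussian binomial
(`transfer_gaussWeight`, resting on `plant_gaussWeight` and the two q-Pascal rules). At `a = 0` and
height `0` only the tree weight remains. It is a product of Gaussian binomials, one per edge, which
telescope at each vertex into the multinomial (`prod_vertexWeight`). -/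

namespace DyckTiling

/-! ### Transfer operators of plane trees -/

section Transfer

variable {K : Type*} [Field K] (q : K)

/-- The weight `q ^ (i * (i + 1) / 2)` times the Gaussian binomial coefficient `a` over `i`. -/
def gaussWeight : ℕ → ℕ → K
  | 0, 0 => 1
  | 0, _ + 1 => 0
  | a + 1, 0 => gaussWeight a 0
  | a + 1, i + 1 => gaussWeight a (i + 1) + q ^ (a + 1) * gaussWeight a i

theorem gaussWeight_zero_right (a : ℕ) : gaussWeight q a 0 = 1 := by
  induction a with
  | zero => rfl
  | succ a ih => rw [gaussWeight, ih]

/-- The second q-Pascal rule. The defining recursion splits off the last factor of `∏ (1 + q ^ j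
z)`; this one splits off the first factor `1 + q z` and rescales `z` to `q z` in the others. -/
theorem gaussWeight_succ_succ (a i : ℕ) : gaussWeight q (a + 1) (i + 1) =
    q ^ (i + 1) * (gaussWeight q a (i + 1) + gaussWeight q a i) := by
  induction a generalizing i with
  | zero => cases i <;> simp [gaussWeight]
  | succ a ih =>
    have hrec (a i : ℕ) : gaussWeight q (a + 1) (i + 1) =
      gaussWeight q a (i + 1) + q ^ (a + 1) * gaussWeight q a i := rfl
    cases i with
    | zero =>
      have h1 := gaussWeight_zero_right q (a + 1)
      have h2 := gaussWeight_zero_right q a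
      linear_combination hrec (a + 1) 0 + ih 0 - q * hrec a 0 +
        (q ^ (a + 2) - q) * h1 + (q - q ^ (a + 2)) * h2
    | succ i =>
      linear_combination hrec (a + 1) (i + 1) + ih (i + 1) + q ^ (a + 2) * ih i -
        q ^ (i + 2) * (hrec a (i + 1) + hrec a i)

/-- Attaching an edge above the root, as an operation on transfer operators. The variable `m` is
the number of layers in which the edge lies in the interior of tiles. -/
def plant (E : ℕ → (ℕ → K) → ℕ → K) (b : ℕ) (g : ℕ → K) (i : ℕ) : K :=
  ∑ m ∈ Finset.Icc b i, ∑ i' ∈ Finset.Icc (max m (i - 1)) i,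
    q ^ (i - m) * E m (fun j => g j + g (j + 1)) i'

/-- The generating function of labellings of a tree (see `Valid`) with least layer `b`, first
height `i` and a weight `f` on the last height. -/
def transfer : BinaryTree Unit → ℕ → (ℕ → K) → ℕ → K
  | .nil, _, f, i => q ^ i * f i
  | .node _ p r, b, f, i => plant q (transfer p) b (transfer r b f) i

variable {q}

theorem plant_succ {E : ℕ → (ℕ → K) → ℕ → K} {c : K}
    (hE : ∀ m g i, E (m + 1) g (i + 1) = c * E m (fun j => g (j + 1)) i) (b : ℕ) (g : ℕ → K)
    (i : ℕ) : plant q E (b + 1) g (i + 1) = c * plant q E b (fun j => g (j + 1)) i := by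
  unfold plant
  rw [← Finset.map_add_right_Icc b i 1, Finset.sum_map, Finset.mul_sum]
  refine Finset.sum_congr rfl fun m hm => ?_
  have : Finset.Icc (max (m + 1) (i + 1 - 1)) (i + 1) =
      (Finset.Icc (max m (i - 1)) i).map (addRightEmbedding 1) := by
    rw [Finset.map_add_right_Icc]
    congr 1
    simp only [Finset.mem_Icc] at hm
    omega
  rw [addRightEmbedding_apply, this, Finset.sum_map, Finset.mul_sum]
  refine Finset.sum_congr rfl fun i' _ => ?_
  rw [addRightEmbedding_apply, hE, Nat.add_sub_add_right]
  ring

theorem plant_smul_add {E : ℕ → (ℕ → K) → ℕ → K}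
    (hE : ∀ m f g c d i, E m (fun j => c * f j + d * g j) i = c * E m f i + d * E m g i)
    (b : ℕ) (f g : ℕ → K) (c d : K) (i : ℕ) :
    plant q E b (fun j => c * f j + d * g j) i = c * plant q E b f i + d * plant q E b g i := by
  simp only [plant, Finset.mul_sum, ← Finset.sum_add_distrib]
  refine Finset.sum_congr rfl fun m _ => Finset.sum_congr rfl fun i' _ => ?_
  rw [mul_left_comm c, mul_left_comm d, ← mul_add, ← hE]
  congr 2
  funext j
  ring

theorem transfer_smul_add (t : BinaryTree Unit) (b : ℕ) (f g : ℕ → K) (c d : K) (i : ℕ) :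
    transfer q t b (fun j => c * f j + d * g j) i =
      c * transfer q t b f i + d * transfer q t b g i := by
  induction t generalizing b f g c d i with
  | nil => simp only [transfer]; ring
  | node _ p r ihp ihr =>
    rw [transfer, show transfer q r b (fun j => c * f j + d * g j) = fun j =>
      c * transfer q r b f j + d * transfer q r b g j from funext (ihr b f g c d),
      plant_smul_add ihp]
    rfl

theorem plant_transfer_smul (p : BinaryTree Unit) (b : ℕ) (g : ℕ → K) (c : K) (i : ℕ) :
    plant q (transfer q p) b (fun j => c * g j) i = c * plant q (transfer q p) b g i := by
  simpa using plant_smul_add (transfer_smul_add (q := q) p) b g g c 0 i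

/-- If the least layer is `b + 1`, all heights and joints can be lowered by one. The terms `h s - l
s` do not change, while each of the `numNodes + 1` empty subtrees loses one from its exponent. -/
theorem transfer_succ (t : BinaryTree Unit) (b : ℕ) (f : ℕ → K) (i : ℕ) :
    transfer q t (b + 1) f (i + 1) =
      q ^ (t.numNodes + 1) * transfer q t b (fun j => f (j + 1)) i := by
  induction t generalizing b f i with
  | nil => simp [transfer, BinaryTree.numNodes]; ring
  | node _ p r ihp ihr =>
    rw [transfer, plant_succ ihp, funext (ihr b f), plant_transfer_smul, transfer,
      BinaryTree.numNodes]
    ring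

theorem plant_zero_zero (E : ℕ → (ℕ → K) → ℕ → K) (g : ℕ → K) :
    plant q E 0 g 0 = E 0 (fun j => g j + g (j + 1)) 0 := by
  simp [plant]

/-- Isolates the term with joint number `0`. The rest has least layer `1`, so `plant_succ` reduces
it to first height `i`. -/
theorem plant_zero_succ (E : ℕ → (ℕ → K) → ℕ → K) (g : ℕ → K) (i : ℕ) :
    plant q E 0 g (i + 1) = plant q E 1 g (i + 1) + q ^ (i + 1) *
      (E 0 (fun j => g j + g (j + 1)) (i + 1) + E 0 (fun j => g j + g (j + 1)) i) := by
  have h1 : Finset.Icc 0 (i + 1) = insert 0 (Finset.Icc 1 (i + 1)) := by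
    ext; simp only [Finset.mem_Icc, Finset.mem_insert]; omega
  have h2 : Finset.Icc (max 0 (i + 1 - 1)) (i + 1) = {i + 1, i} := by
    ext; simp only [Finset.mem_Icc, Finset.mem_insert, Finset.mem_singleton]; omega
  rw [plant, plant, h1, Finset.sum_insert (by simp), h2, Finset.sum_pair (by simp), add_comm,
    Nat.sub_zero, mul_add]

end Transfer

/-! ### Gaussian binomials and the action on Gaussian weights -/

section QFactorial

open RatFunc

/-- Vanishing would give `X ^ (n + 1) = 1` by the geometric sum, which a degree comparison excludes.
-/
theorem qInt_ne_zero (n : ℕ) : qInt (n + 1) ≠ 0 := by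
  intro h
  have h1 : qInt (n + 1) * (X - 1) = X ^ (n + 1) - 1 := geom_sum_mul _ _
  have h2 : (X : RatFunc ℚ) ^ (n + 1) = 1 := by
    rw [← sub_eq_zero, ← h1, h, zero_mul]
  have h3 : (Polynomial.X : Polynomial ℚ) ^ (n + 1) = 1 := by
    apply RatFunc.algebraMap_injective ℚ
    simpa using h2
  simpa using congrArg Polynomial.natDegree h3

theorem qFactorial_succ (n : ℕ) : qFactorial (n + 1) = qFactorial n * qInt (n + 1) :=
  Finset.prod_Icc_succ_top (by omega) _

theorem qFactorial_ne_zero (n : ℕ) : qFactorial n ≠ 0 := by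
  induction n with
  | zero => simp [qFactorial]
  | succ n ih => rw [qFactorial_succ]; exact mul_ne_zero ih (qInt_ne_zero n)

theorem qInt_add (m n : ℕ) : qInt (m + n) = qInt m + X ^ m * qInt n := by
  simp only [qInt, Finset.sum_range_add, Finset.mul_sum, pow_add]

/-- The Gaussian binomial coefficient `[a + n]! / ([a]! [n]!)`. -/
noncomputable def gaussBinom (a n : ℕ) : RatFunc ℚ :=
  qFactorial (a + n) / (qFactorial a * qFactorial n)

theorem gaussBinom_zero_left (n : ℕ) : gaussBinom 0 n = 1 := by
  simp [gaussBinom, qFactorial_ne_zero, show qFactorial 0 = 1 by simp [qFactorial]]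

theorem gaussBinom_zero_right (n : ℕ) : gaussBinom n 0 = 1 := by
  simp [gaussBinom, qFactorial_ne_zero, show qFactorial 0 = 1 by simp [qFactorial]]

theorem gaussBinom_succ_succ (a n : ℕ) : gaussBinom (a + 1) (n + 1) =
    gaussBinom a (n + 1) + X ^ (a + 1) * gaussBinom (a + 1) n := by
  have h := qInt_add (a + 1) (n + 1)
  simp only [gaussBinom]
  rw [show a + 1 + (n + 1) = a + n + 1 + 1 by omega, show a + (n + 1) = a + n + 1 by omega,
    show a + 1 + n = a + n + 1 by omega]
  rw [show a + 1 + (n + 1) = a + n + 1 + 1 by omega] at h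
  simp only [qFactorial_succ, h]
  have h1 := qFactorial_ne_zero a
  have h2 := qFactorial_ne_zero n
  have h3 := qInt_ne_zero a
  have h4 := qInt_ne_zero n
  field_simp

theorem gaussBinom_comm (a n : ℕ) : gaussBinom a n = gaussBinom n a := by
  rw [gaussBinom, gaussBinom, add_comm, mul_comm (qFactorial a)]

/-- Both sides are the trinomial coefficient of `a`, `m`, `n`, with the parts merged in different
orders. -/
theorem gaussBinom_mul_gaussBinom (a m n : ℕ) :
    gaussBinom a m * gaussBinom (a + m) n = gaussBinom n m * gaussBinom a (n + m) := by
  have h1 := qFactorial_ne_zero a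
  have h2 := qFactorial_ne_zero n
  have h3 := qFactorial_ne_zero m
  have h4 := qFactorial_ne_zero (a + m)
  have h5 := qFactorial_ne_zero (n + m)
  simp only [gaussBinom]
  rw [show a + (n + m) = a + m + n by omega]
  field_simp

/-- Induction on `a`: the recursion of `gaussWeight` in `a` splits the input into the one for `a`
and a multiple of `X ^ (a + 1)` to which `hp` applies, matching the Pascal rule for `gaussBinom`.
For positive first height, `plant_zero_succ` and `plant_succ` leave a planted shifted vector, which
is eliminated by means of the induction hypothesis at both `i + 1` and `i`. -/
theorem plant_gaussWeight {p : BinaryTree Unit} {n : ℕ} (hn : p.numNodes = n) {c : RatFunc ℚ}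
    (hp : ∀ a f, (∀ j, X ^ j * f j = gaussWeight X a j) → ∀ i,
      transfer X p 0 f i = c * gaussBinom a n * gaussWeight X (a + n) i) (a i : ℕ) :
    plant X (transfer X p) 0 (gaussWeight X a) i =
      c * gaussBinom a (n + 1) * gaussWeight X (a + n + 1) i := by
  induction a generalizing i with
  | zero =>
    have h0 : ∀ i, transfer X p 0 (fun j => gaussWeight X 0 j + gaussWeight X 0 (j + 1)) i =
        c * gaussWeight X n i := by
      intro i
      rw [hp 0, gaussBinom_zero_left, mul_one, zero_add]
      rintro (_ | j) <;> simp [gaussWeight]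
    rw [gaussBinom_zero_left, mul_one, zero_add]
    cases i with
    | zero => rw [plant_zero_zero, h0, gaussWeight_zero_right, gaussWeight_zero_right]
    | succ i =>
      rw [plant_zero_succ, plant_succ (transfer_succ p), h0, h0, gaussWeight_succ_succ]
      have := plant_transfer_smul (q := (X : RatFunc ℚ)) p 0
        (fun j => gaussWeight X 0 (j + 1)) 0 i
      simp only [gaussWeight, mul_zero, zero_mul] at this ⊢
      rw [this]
      ring
  | succ a ih =>
    have hrec (a i : ℕ) : gaussWeight (X : RatFunc ℚ) (a + 1) (i + 1) =
      gaussWeight X a (i + 1) + X ^ (a + 1) * gaussWeight X a i := rfl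
    -- Up to the factor `X ^ (a + 1)`, `f` is the increment of `gaussWeight X a j + gaussWeight X a
    -- (j + 1)` when `a` grows by one. By the second Pascal rule it satisfies the hypothesis of `hp`
    -- at `a + 1`.
    let f : ℕ → RatFunc ℚ := fun j => gaussWeight X a j + if j = 0 then 0 else
      gaussWeight X a (j - 1)
    have hf : ∀ j, X ^ j * f j = gaussWeight X (a + 1) j := by
      rintro (_ | j)
      · simp [f, gaussWeight]
      · simp [f, gaussWeight_succ_succ]
    have hE : ∀ i, transfer X p 0
        (fun j => gaussWeight X (a + 1) j + gaussWeight X (a + 1) (j + 1)) i =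
        transfer X p 0 (fun j => gaussWeight X a j + gaussWeight X a (j + 1)) i +
          X ^ (a + 1) * (c * gaussBinom (a + 1) n * gaussWeight X (a + 1 + n) i) := by
      intro i
      have h := transfer_smul_add (q := (X : RatFunc ℚ)) p 0
        (fun j => gaussWeight X a j + gaussWeight X a (j + 1)) f 1 (X ^ (a + 1)) i
      rw [one_mul] at h
      rw [← hp (a + 1) f hf, ← h]
      congr 1
      funext j
      cases j with
      | zero =>
        simp only [f, hrec, gaussWeight_zero_right, if_true]
        ring
      | succ j =>
        simp only [f, hrec, Nat.add_one_ne_zero, if_false, Nat.add_sub_cancel]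
        ring
    cases i with
    | zero =>
      have h0 := ih 0
      rw [plant_zero_zero, gaussWeight_zero_right] at h0 ⊢
      rw [hE, h0, gaussBinom_succ_succ, gaussWeight_zero_right]
      ring
    | succ i =>
      have h1 := ih (i + 1)
      rw [plant_zero_succ, plant_succ (transfer_succ p)] at h1 ⊢
      -- The shifted vector for `a + 1` is the shifted vector for `a`, whose image also occurs in
      -- `h1`, plus `X ^ (a + 1)` times the unshifted one, whose image is `ih i`.
      have h2 := plant_smul_add (q := (X : RatFunc ℚ)) (transfer_smul_add (q := (X : RatFunc ℚ)) p) 0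
        (fun j => gaussWeight X a (j + 1)) (gaussWeight X a) 1 (X ^ (a + 1)) i
      simp only [one_mul, ← hrec] at h2
      have h3 := gaussWeight_succ_succ (X : RatFunc ℚ) (a + 1 + n) i
      rw [h2, hE, hE, gaussBinom_succ_succ, ih i, hn]
      have h4 := hrec (a + 1 + n) i
      rw [hn] at h1
      rw [show a + 1 + n = a + n + 1 by omega] at *
      linear_combination h1 - X ^ (a + 1) * c * gaussBinom (a + 1) n * h3 -
        c * gaussBinom a (n + 1) * h4

/-- The product of Gaussian binomial coefficients belonging to a binary tree. -/
noncomputable def treeWeight : BinaryTree Unit → RatFunc ℚ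
  | .nil => 1
  | .node _ p r => gaussBinom r.numNodes (p.numNodes + 1) * treeWeight p * treeWeight r

/-- The part after the first return raises the index from `a` to `a + r.numNodes`, the planted part
then raises it by `p.numNodes + 1`. The two binomials regroup by the trinomial identity. The
hypothesis on `f` absorbs the factor `q ^ i` contributed by an empty tree. -/
theorem transfer_gaussWeight (t : BinaryTree Unit) (a : ℕ) (f : ℕ → RatFunc ℚ)
    (hf : ∀ j, X ^ j * f j = gaussWeight X a j) (i : ℕ) :
    transfer X t 0 f i =
      treeWeight t * gaussBinom a t.numNodes * gaussWeight X (a + t.numNodes) i := by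
  induction t generalizing a f i with
  | nil => simp [transfer, hf, treeWeight, gaussBinom_zero_right]
  | node _ p r ihp ihr =>
    rw [transfer, funext (ihr a f hf), plant_transfer_smul, plant_gaussWeight rfl ihp, treeWeight,
      BinaryTree.numNodes]
    rw [show a + (p.numNodes + r.numNodes + 1) = a + r.numNodes + p.numNodes + 1 by omega]
    have h := gaussBinom_mul_gaussBinom a r.numNodes (p.numNodes + 1)
    rw [show p.numNodes + 1 + r.numNodes = p.numNodes + r.numNodes + 1 by omega,
      gaussBinom_comm (p.numNodes + 1)] at h
    linear_combination treeWeight r * treeWeight p *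
      gaussWeight X (a + r.numNodes + p.numNodes + 1) i * h

theorem transfer_zero (t : BinaryTree Unit) :
    transfer X t 0 (fun j => if j = 0 then 1 else 0) 0 = treeWeight t := by
  rw [transfer_gaussWeight t 0, gaussBinom_zero_left, gaussWeight_zero_right, mul_one, mul_one]
  rintro (_ | j) <;> simp [gaussWeight]

/-! ### Plane trees and their vertex weights -/

theorem planeTree_zero : planeTree 0 = .node [] := by
  rw [planeTree]; simp

theorem planeTree_nest_add (p r : DyckWord) :
    planeTree (p.nest + r) = .node (planeTree p :: (planeTree r).children) := by
  rw [planeTree, if_neg (by simp)]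
  simp

theorem numEdges_planeTree (w : DyckWord) : (planeTree w).numEdges = w.semilength := by
  rw [← DyckWord.ofTree_toTree w]
  induction w.toTree with
  | nil => simp [DyckWord.ofTree, planeTree_zero, PlaneTree.numEdges]
  | node _ p r ihp ihr =>
    rw [DyckWord.ofTree, planeTree_nest_add, PlaneTree.numEdges]
    generalize planeTree (DyckWord.ofTree r) = t at ihr ⊢
    obtain ⟨ts⟩ := t
    rw [PlaneTree.numEdges] at ihr
    simp [PlaneTree.children, ihp, ihr]

/-- The contribution of a vertex of a plane tree, depending on the subtree rooted at it. -/
noncomputable def vertexWeight (t : PlaneTree) : RatFunc ℚ :=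
  qMultinomial t.numEdges (t.children.map fun s => s.numEdges + 1)

/-- A multinomial with at most one part is trivial, so the product may run over all vertices, which
suits the recursion better. -/
theorem vertexWeight_of_not_ramified {t : PlaneTree} (h : ¬ 2 ≤ t.children.length) :
    vertexWeight t = 1 := by
  obtain ⟨ts⟩ := t
  simp only [vertexWeight, PlaneTree.children] at h ⊢
  match ts, h with
  | [], _ => simp [qMultinomial, PlaneTree.numEdges, qFactorial]
  | [s], _ => simp [qMultinomial, PlaneTree.numEdges, qFactorial_ne_zero]
  | _ :: _ :: _, h => exact absurd (by simp) h

/-- Peeling the leftmost branch off a multinomial leaves a Gaussian binomial, the factor that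
`treeWeight` attaches to a node. -/
theorem vertexWeight_cons (s : PlaneTree) (ts : List PlaneTree) :
    vertexWeight (.node (s :: ts)) =
      gaussBinom (PlaneTree.node ts).numEdges (s.numEdges + 1) * vertexWeight (.node ts) := by
  have h1 := qFactorial_ne_zero (PlaneTree.node ts).numEdges
  simp only [vertexWeight, qMultinomial, gaussBinom, PlaneTree.children, PlaneTree.numEdges,
    List.map_cons, List.sum_cons, List.prod_cons] at h1 ⊢
  rw [add_comm (s.numEdges + 1)]
  field_simp

theorem prod_ramificationPoints (t : PlaneTree) :
    (t.ramificationPoints.map vertexWeight).prod = (t.vertices.map vertexWeight).prod := by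
  rw [PlaneTree.ramificationPoints]
  induction t.vertices with
  | nil => rfl
  | cons s l ih =>
    by_cases h : 2 ≤ s.children.length
    · simp [h, ih]
    · simp [h, ih, vertexWeight_of_not_ramified h]

theorem prod_vertexWeight (t : BinaryTree Unit) :
    ((planeTree (DyckWord.ofTree t)).vertices.map vertexWeight).prod = treeWeight t := by
  induction t with
  | nil =>
    simp [DyckWord.ofTree, planeTree_zero, PlaneTree.vertices, treeWeight,
      vertexWeight_of_not_ramified, PlaneTree.children]
  | node _ p r ihp ihr =>
    have h1 := numEdges_planeTree (DyckWord.ofTree r)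
    have h2 := numEdges_planeTree (DyckWord.ofTree p)
    rw [← DyckWord.numNodes_toTree, DyckWord.toTree_ofTree] at h1 h2
    rw [DyckWord.ofTree, planeTree_nest_add, treeWeight, ← ihp, ← ihr, ← h1, ← h2]
    generalize planeTree (DyckWord.ofTree r) = t
    obtain ⟨ts⟩ := t
    simp only [PlaneTree.vertices, PlaneTree.children, List.map_cons, List.flatten_cons,
      List.map_append, List.prod_cons, List.prod_append, vertexWeight_cons]
    ring

end QFactorial

/-! ### Labellings along the first-return decomposition -/

section Labelling

/-- Validity of heights `h` and joints `l` along the part of a path encoded by a binary tree and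
starting at column `s`. Here `h x` is the number of boxes in column `x`, and `l x` is the number of
tiles containing boxes of both columns `x` and `x + 1`; all joints have to be at least `b`. -/
def Valid (h l : ℕ → ℕ) : BinaryTree Unit → ℕ → ℕ → Prop
  | .nil, s, b => b ≤ h s
  | .node _ p r, s, b =>
    (b ≤ l s ∧ l s ≤ h s ∧ l (s + 2 * p.numNodes + 1) = l s) ∧
    (h s ≤ h (s + 1) + 1 ∧ h (s + 1) ≤ h s) ∧
    (h (s + 2 * p.numNodes + 1) ≤ h (s + 2 * p.numNodes + 2) ∧
      h (s + 2 * p.numNodes + 2) ≤ h (s + 2 * p.numNodes + 1) + 1) ∧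
    Valid h l p (s + 1) (l s) ∧ Valid h l r (s + 2 * p.numNodes + 2) b

/-- The exponent contributed by a labelling. -/
def labelWeight (h l : ℕ → ℕ) : BinaryTree Unit → ℕ → ℕ
  | .nil, s => h s
  | .node _ p r, s =>
    h s - l s + labelWeight h l p (s + 1) + labelWeight h l r (s + 2 * p.numNodes + 2)

theorem Valid.le_first {h l : ℕ → ℕ} {t : BinaryTree Unit} {s b : ℕ} (hv : Valid h l t s b) :
    b ≤ h s := by
  cases t with
  | nil => exact hv
  | node _ p r => exact hv.1.1.trans hv.1.2.1

theorem Valid.le_last {h l : ℕ → ℕ} {t : BinaryTree Unit} {s b : ℕ} (hv : Valid h l t s b) :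
    b ≤ h (s + 2 * t.numNodes) := by
  induction t generalizing s b with
  | nil => exact hv
  | node _ p r ihp ihr =>
    convert ihr hv.2.2.2.2 using 2
    rw [BinaryTree.numNodes]
    ring

theorem Valid.congr {h l h' l' : ℕ → ℕ} {t : BinaryTree Unit} {s b : ℕ}
    (hv : Valid h l t s b) (hh : ∀ x, s ≤ x → x ≤ s + 2 * t.numNodes → h' x = h x)
    (hl : ∀ x, s ≤ x → x < s + 2 * t.numNodes → l' x = l x) : Valid h' l' t s b := by
  induction t generalizing s b with
  | nil => rw [Valid, hh s le_rfl (by simp)]; exact hv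
  | node _ p r ihp ihr =>
    rw [BinaryTree.numNodes] at hh hl
    obtain ⟨h1, h2, h3, h4, h5⟩ := hv
    rw [Valid, hh s, hl s, hh (s + 1), hl (s + 2 * p.numNodes + 1),
      hh (s + 2 * p.numNodes + 1), hh (s + 2 * p.numNodes + 2)]
    · refine ⟨h1, h2, h3, ihp h4 ?_ ?_, ihr h5 ?_ ?_⟩ <;> intro x hx hx'
      · exact hh x (by omega) (by omega)
      · exact hl x (by omega) (by omega)
      · exact hh x (by omega) (by omega)
      · exact hl x (by omega) (by omega)
    all_goals omega

theorem labelWeight_congr {h l h' l' : ℕ → ℕ} {t : BinaryTree Unit} {s : ℕ}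
    (hh : ∀ x, s ≤ x → x ≤ s + 2 * t.numNodes → h' x = h x)
    (hl : ∀ x, s ≤ x → x < s + 2 * t.numNodes → l' x = l x) :
    labelWeight h' l' t s = labelWeight h l t s := by
  induction t generalizing s with
  | nil => exact hh s le_rfl (by simp)
  | node _ p r ihp ihr =>
    rw [BinaryTree.numNodes] at hh hl
    rw [labelWeight, labelWeight, hh s, hl s, ihp, ihr]
    · intro x hx hx'; exact hh x (by omega) (by omega)
    · intro x hx hx'; exact hl x (by omega) (by omega)
    · intro x hx hx'; exact hh x (by omega) (by omega)
    · intro x hx hx'; exact hl x (by omega) (by omega)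
    all_goals omega

/-- A pair of functions supported on the columns starting at `s` which is a valid labelling with
first height `i`. -/
structure IsLabelling (t : BinaryTree Unit) (s b i : ℕ) (c : (ℕ → ℕ) × (ℕ → ℕ)) : Prop where
  valid : Valid c.1 c.2 t s b
  first : c.1 s = i
  support_fst : ∀ x, x < s ∨ s + 2 * t.numNodes < x → c.1 x = 0
  support_snd : ∀ x, x < s ∨ s + 2 * t.numNodes ≤ x → c.2 x = 0

/-- The labelling of a nonempty path given by labellings of the part inside the first return and
of the part after it. -/
def glue (s e i m : ℕ) (c₁ c₂ : (ℕ → ℕ) × (ℕ → ℕ)) : (ℕ → ℕ) × (ℕ → ℕ) :=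
  (fun x => if x = s then i else if x < e then c₁.1 x else c₂.1 x,
    fun x => if x = s ∨ x + 1 = e then m else if x < e then c₁.2 x else c₂.2 x)

/-- The labelling of the columns from `s` to `e`. -/
def cut (s e : ℕ) (c : (ℕ → ℕ) × (ℕ → ℕ)) : (ℕ → ℕ) × (ℕ → ℕ) :=
  (fun x => if s ≤ x ∧ x ≤ e then c.1 x else 0, fun x => if s ≤ x ∧ x < e then c.2 x else 0)

theorem IsLabelling.glue {p r : BinaryTree Unit} {s b i i' m j : ℕ}
    {c₁ c₂ : (ℕ → ℕ) × (ℕ → ℕ)} (hbm : b ≤ m) (hmi : m ≤ i) (hi : i ≤ i' + 1) (hi' : i' ≤ i)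
    (h₁ : IsLabelling p (s + 1) m i' c₁)
    (hj : c₁.1 (s + 2 * p.numNodes + 1) ≤ j) (hj' : j ≤ c₁.1 (s + 2 * p.numNodes + 1) + 1)
    (h₂ : IsLabelling r (s + 2 * p.numNodes + 2) b j c₂) :
    IsLabelling (.node () p r) s b i (glue s (s + 2 * p.numNodes + 2) i m c₁ c₂) where
  valid := by
    have e1 := h₁.first
    have e2 := h₂.first
    have em : (DyckTiling.glue s (s + 2 * p.numNodes + 2) i m c₁ c₂).2 s = m := by
      simp [DyckTiling.glue]
    rw [Valid, em]
    refine ⟨?_, ?_, ?_, h₁.valid.congr ?_ ?_, h₂.valid.congr ?_ ?_⟩ <;>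
      simp only [DyckTiling.glue] <;> grind
  first := by simp [DyckTiling.glue]
  support_fst x hx := by
    have := h₁.support_fst x
    have := h₂.support_fst x
    simp only [DyckTiling.glue, BinaryTree.numNodes] at *
    grind
  support_snd x hx := by
    have := h₁.support_snd x
    have := h₂.support_snd x
    simp only [DyckTiling.glue, BinaryTree.numNodes] at *
    grind

theorem IsLabelling.cut {t : BinaryTree Unit} {s b : ℕ} {c : (ℕ → ℕ) × (ℕ → ℕ)}
    (hv : Valid c.1 c.2 t s b) :
    IsLabelling t s b (c.1 s) (cut s (s + 2 * t.numNodes) c) where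
  valid := hv.congr (fun x h1 h2 => if_pos ⟨h1, h2⟩) (fun x h1 h2 => if_pos ⟨h1, h2⟩)
  first := if_pos ⟨le_rfl, by omega⟩
  support_fst x hx := if_neg (by omega)
  support_snd x hx := if_neg (by omega)

theorem cut_glue_left {p : BinaryTree Unit} {s i i' m e : ℕ} {c₁ c₂ : (ℕ → ℕ) × (ℕ → ℕ)}
    (h₁ : IsLabelling p (s + 1) m i' c₁) (he : e = s + 2 * p.numNodes + 2) :
    DyckTiling.cut (s + 1) (s + 1 + 2 * p.numNodes) (glue s e i m c₁ c₂) = c₁ := by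
  ext x
  · have := h₁.support_fst x
    simp only [DyckTiling.cut, DyckTiling.glue]
    grind
  · have := h₁.support_snd x
    simp only [DyckTiling.cut, DyckTiling.glue]
    grind

theorem cut_glue_right {r : BinaryTree Unit} {s b i j m e : ℕ} {c₁ c₂ : (ℕ → ℕ) × (ℕ → ℕ)}
    (h₂ : IsLabelling r e b j c₂) (he : s < e) :
    DyckTiling.cut e (e + 2 * r.numNodes) (glue s e i m c₁ c₂) = c₂ := by
  ext x
  · have := h₂.support_fst x
    simp only [DyckTiling.cut, DyckTiling.glue]
    grind
  · have := h₂.support_snd x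
    simp only [DyckTiling.cut, DyckTiling.glue]
    grind

theorem IsLabelling.glue_cut {p r : BinaryTree Unit} {s b i e : ℕ} {c : (ℕ → ℕ) × (ℕ → ℕ)}
    (h : IsLabelling (.node () p r) s b i c) (he : e = s + 2 * p.numNodes + 2) :
    DyckTiling.glue s e i (c.2 s) (DyckTiling.cut (s + 1) (s + 1 + 2 * p.numNodes) c)
      (DyckTiling.cut e (e + 2 * r.numNodes) c) = c := by
  have h1 := h.first
  have h2 := h.valid.1.2.2
  ext x
  · have := h.support_fst x
    simp only [DyckTiling.cut, DyckTiling.glue, BinaryTree.numNodes] at *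
    grind
  · have := h.support_snd x
    simp only [DyckTiling.cut, DyckTiling.glue, BinaryTree.numNodes] at *
    grind

/-- Finiteness and the generating function are proved together: cutting at the first return is
inverse to gluing, and under it the sum over labellings factors as in the definition of `plant`. -/
theorem exists_finset_isLabelling {K : Type*} [Field K] (q : K) (t : BinaryTree Unit)
    (s b i : ℕ) (hbi : b ≤ i) : ∃ S : Finset ((ℕ → ℕ) × (ℕ → ℕ)),
      (∀ c, c ∈ S ↔ IsLabelling t s b i c) ∧ ∀ f : ℕ → K,
        ∑ c ∈ S, q ^ labelWeight c.1 c.2 t s * f (c.1 (s + 2 * t.numNodes)) =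
          transfer q t b f i := by
  induction t generalizing s b i with
  | nil =>
    refine ⟨{(fun x => if x = s then i else 0, fun _ => 0)}, fun c => ?_, fun f => ?_⟩
    · rw [Finset.mem_singleton]
      constructor
      · rintro rfl
        refine ⟨by simpa [Valid], by simp, ?_, by simp⟩
        intro x hx
        simp at hx ⊢
        omega
      · rintro ⟨h1, h2, h3, h4⟩
        simp only [BinaryTree.numNodes] at h3 h4
        ext x
        · by_cases hx : x = s
          · simp [hx, h2]
          · simp [hx, h3 x (by omega)]
        · simp [h4 x (by omega)]
    · simp [labelWeight, transfer]
  | node _ p r ihp ihr =>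
    set e := s + 2 * p.numNodes + 2 with he
    choose Sp hSp hSp' using fun m i' (h : m ≤ i') => ihp (s + 1) m i' h
    choose Sr hSr hSr' using fun j (h : b ≤ j) => ihr e b j h
    classical
    -- The default `∅` is the correct value: the first height of a labelling is never less than its
    -- least layer. The same holds for `Tr`.
    let Tp : ℕ → ℕ → Finset ((ℕ → ℕ) × (ℕ → ℕ)) := fun m i' => if h : m ≤ i' then Sp m i' h else ∅
    let Tr : ℕ → Finset ((ℕ → ℕ) × (ℕ → ℕ)) := fun j => if h : b ≤ j then Sr j h else ∅
    have hTp {m i' c} : c ∈ Tp m i' ↔ IsLabelling p (s + 1) m i' c := by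
      by_cases h : m ≤ i'
      · simp only [Tp, dif_pos h, hSp]
      · simp only [Tp, dif_neg h, Finset.notMem_empty, false_iff]
        exact fun hc => h (hc.first ▸ hc.valid.le_first)
    have hTr {j c} : c ∈ Tr j ↔ IsLabelling r e b j c := by
      by_cases h : b ≤ j
      · simp only [Tr, dif_pos h, hSr]
      · simp only [Tr, dif_neg h, Finset.notMem_empty, false_iff]
        exact fun hc => h (hc.first ▸ hc.valid.le_first)
    -- The data of a labelling in order: the joint number of the arch, the first height under it,
    -- the labelling under it, the height after its closing step, the labelling of the rest.
    let I := (Finset.Icc b i).sigma fun m => (Finset.Icc (max m (i - 1)) i).sigma fun i' =>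
      (Tp m i').sigma fun c₁ =>
        (Finset.Icc (c₁.1 (s + 2 * p.numNodes + 1)) (c₁.1 (s + 2 * p.numNodes + 1) + 1)).sigma Tr
    let g : (Σ _ : ℕ, Σ _ : ℕ, Σ _ : (ℕ → ℕ) × (ℕ → ℕ), Σ _ : ℕ, (ℕ → ℕ) × (ℕ → ℕ)) →
        (ℕ → ℕ) × (ℕ → ℕ) := fun x => glue s e i x.1 x.2.2.1 x.2.2.2.2
    have hI {m i' c₁ j c₂} (h : (⟨m, i', c₁, j, c₂⟩ :
        Σ _ : ℕ, Σ _ : ℕ, Σ _ : (ℕ → ℕ) × (ℕ → ℕ), Σ _ : ℕ, (ℕ → ℕ) × (ℕ → ℕ)) ∈ I) :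
        (b ≤ m ∧ m ≤ i) ∧ (i ≤ i' + 1 ∧ i' ≤ i) ∧ IsLabelling p (s + 1) m i' c₁ ∧
        (c₁.1 (s + 2 * p.numNodes + 1) ≤ j ∧ j ≤ c₁.1 (s + 2 * p.numNodes + 1) + 1) ∧
        IsLabelling r e b j c₂ := by
      simp only [I, Finset.mem_sigma, hTp, hTr, Finset.mem_Icc] at h
      refine ⟨h.1, ⟨by omega, by omega⟩, h.2.2.1, h.2.2.2⟩
    have hinj : Set.InjOn g I := by
      rintro ⟨m, i', c₁, j, c₂⟩ h ⟨m', i'', c₁', j', c₂'⟩ h' heq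
      obtain ⟨-, -, h1, -, h2⟩ := hI h
      obtain ⟨-, -, h1', -, h2'⟩ := hI h'
      simp only [g] at heq
      have e1 := (cut_glue_left (i := i) (c₂ := c₂) h1 he).symm.trans
        ((congrArg _ heq).trans (cut_glue_left h1' he))
      have e2 := (cut_glue_right (s := s) (i := i) (m := m) (c₁ := c₁) h2 (by omega)).symm.trans
        ((congrArg _ heq).trans (cut_glue_right h2' (by omega)))
      have e3 : m = m' := by simpa [glue] using congrFun (congrArg Prod.snd heq) s
      subst e1 e2 e3
      obtain rfl := h1.first.symm.trans h1'.first
      obtain rfl := h2.first.symm.trans h2'.first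
      rfl
    refine ⟨I.image g, fun c => ?_, fun f => ?_⟩
    · rw [Finset.mem_image]
      constructor
      · rintro ⟨⟨m, i', c₁, j, c₂⟩, h, rfl⟩
        obtain ⟨h1, h2, h3, h4, h5⟩ := hI h
        exact IsLabelling.glue h1.1 h1.2 h2.1 h2.2 h3 h4.1 h4.2 h5
      · intro h
        obtain ⟨h1, h2, h3, h4, h5⟩ := h.valid
        refine ⟨⟨c.2 s, c.1 (s + 1), cut (s + 1) (s + 1 + 2 * p.numNodes) c, c.1 e,
          cut e (e + 2 * r.numNodes) c⟩, ?_, h.glue_cut he⟩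
        have := h4.le_first
        have h6 := h.first
        have h7 : (cut (s + 1) (s + 1 + 2 * p.numNodes) c).1 (s + 2 * p.numNodes + 1) =
          c.1 (s + 2 * p.numNodes + 1) := if_pos (by omega)
        simp only [I, Finset.mem_sigma, hTp, hTr, Finset.mem_Icc, h7]
        refine ⟨by omega, by omega, IsLabelling.cut h4, by omega, IsLabelling.cut h5⟩
    · rw [Finset.sum_image hinj, transfer, plant, Finset.sum_sigma]
      refine Finset.sum_congr rfl fun m hm => ?_
      rw [Finset.sum_sigma]
      refine Finset.sum_congr rfl fun i' hi' => ?_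
      rw [Finset.mem_Icc] at hm hi'
      have hmi' : m ≤ i' := by omega
      rw [Finset.sum_sigma, ← hSp' m i' hmi', Finset.mul_sum, show Tp m i' = Sp m i' hmi' from
        dif_pos hmi']
      refine Finset.sum_congr rfl fun c₁ hc₁ => ?_
      rw [hSp] at hc₁
      have hle := hc₁.valid.le_last
      rw [show s + 1 + 2 * p.numNodes = s + 2 * p.numNodes + 1 by ring] at hle ⊢
      set j := c₁.1 (s + 2 * p.numNodes + 1) with hj
      have hTr' (k) (hk : b ≤ k) : ∑ c₂ ∈ Tr k,
          q ^ labelWeight c₂.1 c₂.2 r e * f (c₂.1 (e + 2 * r.numNodes)) =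
          transfer q r b f k := by
        rw [← hSr' k hk, show Tr k = Sr k hk from dif_pos hk]
      rw [Finset.sum_sigma, show Finset.Icc j (j + 1) = {j, j + 1} by
        ext; simp only [Finset.mem_Icc, Finset.mem_insert, Finset.mem_singleton]; omega,
        ← Finset.sum_pair (f := transfer q r b f) (by omega : j ≠ j + 1), ← mul_assoc,
        Finset.mul_sum]
      refine Finset.sum_congr rfl fun k hk => ?_
      have hk' : b ≤ k := by
        simp only [Finset.mem_insert, Finset.mem_singleton] at hk
        omega
      rw [← hTr' k hk', Finset.mul_sum]
      refine Finset.sum_congr rfl fun c₂ hc₂ => ?_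
      have hw : labelWeight (g ⟨m, i', c₁, k, c₂⟩).1 (g ⟨m, i', c₁, k, c₂⟩).2 (.node () p r) s =
          (i - m) + labelWeight c₁.1 c₁.2 p (s + 1) + labelWeight c₂.1 c₂.2 r e := by
        rw [labelWeight]
        congr 1
        · congr 1
          · simp [g, glue]
          · apply labelWeight_congr <;> intro x h1 h2 <;> simp only [g, glue] <;> grind
        · apply labelWeight_congr <;> intro x h1 h2 <;> simp only [g, glue] <;> grind
      have hl : (g ⟨m, i', c₁, k, c₂⟩).1 (s + 2 * (BinaryTree.node () p r).numNodes) =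
          c₂.1 (e + 2 * r.numNodes) := by
        simp only [g, glue, BinaryTree.numNodes]
        grind
      rw [hl, hw, pow_add, pow_add]
      ring

end Labelling

/-! ### Height functions of Dyck paths -/

section Height

theorem height_nonneg (w : DyckWord) (x : ℕ) : 0 ≤ height w x := by
  have := w.count_D_le_count_U x
  simp only [height]; omega

@[simp]
theorem height_zero_right (w : DyckWord) : height w 0 = 0 := by simp [height]

theorem height_of_le {w : DyckWord} {x : ℕ} (h : 2 * w.semilength ≤ x) : height w x = 0 := by
  rw [w.two_mul_semilength_eq_length] at h
  simp [height, List.take_of_length_le h, w.count_U_eq_count_D]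

theorem height_succ {w : DyckWord} {x : ℕ} (h : x < 2 * w.semilength) :
    height w (x + 1) = height w x + 1 ∨ height w (x + 1) = height w x - 1 := by
  rw [w.two_mul_semilength_eq_length] at h
  simp only [height, List.take_add_one, List.getElem?_eq_getElem h, List.count_append,
    Option.toList_some]
  rcases (w.toList[x]).dichotomy with h | h <;> rw [h] <;> simp <;> omega

theorem even_height_add {w : DyckWord} {x : ℕ} (h : x ≤ 2 * w.semilength) :
    Even (height w x + x) := by
  induction x with
  | zero => simp
  | succ x ih =>
    obtain ⟨r, hr⟩ := ih (by omega)
    rcases height_succ (w := w) (x := x) (by omega) with h | h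
    · exact ⟨r + 1, by push_cast; omega⟩
    · exact ⟨r, by push_cast; omega⟩

/-- A function with the properties of the heights of a Dyck path comes from a Dyck path. -/
theorem exists_height_eq {n : ℕ} {g : ℕ → ℤ} (h0 : g 0 = 0) (hn : g (2 * n) = 0)
    (hg : ∀ x, x ≤ 2 * n → 0 ≤ g x)
    (hs : ∀ x, x < 2 * n → g (x + 1) = g x + 1 ∨ g (x + 1) = g x - 1) :
    ∃ w : DyckWord, w.semilength = n ∧ ∀ x, x ≤ 2 * n → height w x = g x := by
  let L : List DyckStep := (List.range (2 * n)).map fun x =>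
    if g (x + 1) = g x + 1 then DyckStep.U else DyckStep.D
  have hlen : L.length = 2 * n := by simp [L]
  have key (x : ℕ) (hx : x ≤ 2 * n) :
      ((L.take x).count DyckStep.U : ℤ) - (L.take x).count DyckStep.D = g x := by
    induction x with
    | zero => simp [h0]
    | succ x ih =>
      have ih := ih (by omega)
      have hx' : x < L.length := by omega
      rw [List.take_add_one, List.getElem?_eq_getElem hx', Option.toList_some,
        List.count_append, List.count_append]
      have : L[x] = if g (x + 1) = g x + 1 then DyckStep.U else DyckStep.D := by simp [L]
      rcases hs x (by omega) with h | h
      · rw [this, if_pos h, h, ← ih]; simp; ring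
      · rw [this, if_neg (by omega), h, ← ih]; simp; ring
  have hL : L.take (2 * n) = L := List.take_of_length_le hlen.le
  have hend := key (2 * n) le_rfl
  rw [hL, hn] at hend
  let w : DyckWord := ⟨L, by omega, fun i => by
    rcases le_total i (2 * n) with hi | hi
    · have := key i hi
      have := hg i hi
      omega
    · rw [List.take_of_length_le (by omega)]; omega⟩
  refine ⟨w, ?_, key⟩
  have := w.two_mul_semilength_eq_length
  have : w.toList.length = 2 * n := hlen
  omega

/-- The path with heights `H` returns at `b` to its height at `a` and is not below it in between. -/
structure IsExcursion (H : ℕ → ℤ) (a b : ℕ) : Prop where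
  le : a ≤ b
  eq : H a = H b
  ge : ∀ x, a ≤ x → x ≤ b → H a ≤ H x

end Height

/-! ### Tiles as translates of stretches of the lower path -/

section Tile

/-- The `k`-th box above the path with heights `H` in column `x`. -/
def layerBox (H : ℕ → ℤ) (x k : ℕ) : Box := (x, H x + 1 + 2 * k)

/-- The `k`-th boxes above the path with heights `H` in the columns from `a` to `b`. -/
def layerTile (H : ℕ → ℤ) (k a b : ℕ) : Finset Box := (Finset.Icc a b).image (layerBox H · k)

variable {H : ℕ → ℤ}

theorem layerBox_inj {x k x' k' : ℕ} : layerBox H x k = layerBox H x' k' ↔ x = x' ∧ k = k' := by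
  simp only [layerBox, Prod.mk.injEq]
  constructor
  · rintro ⟨rfl, h⟩
    exact ⟨rfl, by omega⟩
  · rintro ⟨rfl, rfl⟩
    exact ⟨rfl, rfl⟩

theorem layerBox_mem_layerTile {x k k' a b : ℕ} :
    layerBox H x k ∈ layerTile H k' a b ↔ k = k' ∧ a ≤ x ∧ x ≤ b := by
  simp only [layerTile, Finset.mem_image, Finset.mem_Icc, layerBox_inj]
  grind

theorem mem_layerTile {c : Box} {k a b : ℕ} :
    c ∈ layerTile H k a b ↔ ∃ x, a ≤ x ∧ x ≤ b ∧ layerBox H x k = c := by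
  simp [layerTile, and_assoc]

theorem layerTile_inj {k a b k' a' b' : ℕ} (hab : a ≤ b) (hab' : a' ≤ b')
    (h : layerTile H k a b = layerTile H k' a' b') : k = k' ∧ a = a' ∧ b = b' := by
  have h1 := (layerBox_mem_layerTile (H := H)).1 (h ▸ layerBox_mem_layerTile.2 ⟨rfl, le_rfl, hab⟩)
  have h2 := (layerBox_mem_layerTile (H := H)).1 (h ▸ layerBox_mem_layerTile.2 ⟨rfl, hab, le_rfl⟩)
  have h3 := (layerBox_mem_layerTile (H := H)).1
    (h.symm ▸ layerBox_mem_layerTile.2 ⟨rfl, le_rfl, hab'⟩)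
  have h4 := (layerBox_mem_layerTile (H := H)).1
    (h.symm ▸ layerBox_mem_layerTile.2 ⟨rfl, hab', le_rfl⟩)
  omega

theorem down_layerBox_succ (x k : ℕ) : Box.down (layerBox H x (k + 1)) = layerBox H x k := by
  simp [Box.down, layerBox]; ring

theorem layerBox_mem_skewShape {l m : DyckWord} {x k h : ℕ} (hx : x ≤ 2 * l.semilength)
    (hh : height m x = height l x + 2 * h) :
    layerBox (height l) x k ∈ skewShape l m ↔ k < h := by
  have := even_height_add hx
  rw [mem_skewShape]
  simp only [layerBox]
  have h1 : Odd ((x : ℤ) + (height l x + 1 + 2 * k)) := by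
    obtain ⟨r, hr⟩ := this
    exact ⟨r + k, by omega⟩
  constructor
  · rintro ⟨-, -, h3⟩; omega
  · intro h3; exact ⟨h1, by omega, by omega⟩

theorem exists_layerBox {l m : DyckWord} {c : Box} (hc : c ∈ skewShape l m)
    (hs : l.semilength = m.semilength) :
    c.1 ≤ 2 * l.semilength ∧ ∃ k, layerBox (height l) c.1 k = c := by
  rw [mem_skewShape] at hc
  obtain ⟨⟨r, hr⟩, h2, h3⟩ := hc
  have hx : c.1 ≤ 2 * l.semilength := by
    by_contra h
    have h4 := height_of_le (w := l) (x := c.1) (by omega)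
    have h5 := height_of_le (w := m) (x := c.1) (by omega)
    omega
  obtain ⟨r', hr'⟩ := even_height_add hx
  refine ⟨hx, ((c.2 - height l c.1 - 1) / 2).toNat, ?_⟩
  rw [layerBox]
  ext
  · rfl
  · simp only
    omega

theorem isDyckTile_layerTile {w : DyckWord} {k a b : ℕ} (hb : b ≤ 2 * w.semilength)
    (h : IsExcursion (height w) a b) : IsDyckTile (layerTile (height w) k a b) := by
  obtain ⟨r, hr⟩ := even_height_add hb
  obtain ⟨r', hr'⟩ := even_height_add (h.le.trans hb)
  have hle := h.le
  have heq := h.eq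
  obtain ⟨n, hn⟩ : ∃ n, b = a + 2 * n := ⟨(b - a) / 2, by omega⟩
  obtain ⟨p, hp, hp'⟩ := exists_height_eq (n := n) (g := fun i => height w (a + i) - height w a)
    (by simp) (by rw [← hn]; omega)
    (fun x hx => by have := h.ge (a + x) (by omega) (by omega); omega)
    (fun x hx => by
      have := height_succ (w := w) (x := a + x) (by omega)
      rw [← add_assoc]
      omega)
  refine ⟨layerBox (height w) a k, p, ?_⟩
  ext c
  simp only [mem_layerTile, ribbon, Finset.mem_image, Finset.mem_range, hp]
  constructor
  · rintro ⟨x, h1, h2, rfl⟩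
    refine ⟨x - a, by omega, ?_⟩
    rw [hp' _ (by omega)]
    have : a + (x - a) = x := by omega
    simp only [layerBox, this, Prod.mk.injEq, true_and]
    ring
  · rintro ⟨i, hi, rfl⟩
    refine ⟨a + i, by omega, by omega, ?_⟩
    rw [hp' _ (by omega)]
    simp only [layerBox, Prod.mk.injEq, true_and]
    ring

/-- Induction on the layer of one box of the tile. A box in layer `0` has nothing of the skew shape
beneath it, so the whole tile must rest on the path. In a higher layer the tile lies over another
one, which is in a single layer by induction. -/
theorem IsCoverInclusive.exists_layer {l m : DyckWord} {D : Finset (Finset Box)}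
    (hD : IsCoverInclusive l m D) {T : Finset Box} (hT : T ∈ D) :
    ∃ k, ∀ c ∈ T, c = layerBox (height l) c.1 k := by
  obtain ⟨c₀, hc₀⟩ : T.Nonempty := by
    obtain ⟨c, p, rfl⟩ := hD.isDyckTile T hT
    simp [ribbon]
  have hsub {T : Finset Box} (hT : T ∈ D) {c : Box} (hc : c ∈ T) : c ∈ skewShape l m :=
    hD.union_eq ▸ Finset.mem_biUnion.2 ⟨T, hT, hc⟩
  obtain ⟨-, k, hk⟩ := exists_layerBox (hsub hT hc₀) hD.below.1
  refine ⟨k, ?_⟩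
  generalize c₀.1 = x at hk
  subst hk
  induction k generalizing T with
  | zero =>
    rcases hD.coverInclusive T hT with h | ⟨T', hT', h⟩
    · intro c hc
      obtain ⟨-, k, hk⟩ := exists_layerBox (hsub hT hc) hD.below.1
      have := h c hc
      rw [← hk, Box.IsUnder] at this
      simp only [Box.down, layerBox] at this
      rw [show (0 : ℕ) = k by omega, hk]
    · have := mem_skewShape.1 (hsub hT' (h (Finset.mem_image_of_mem _ hc₀)))
      simp [Box.down, layerBox] at this
      omega
  | succ k ih =>
    rcases hD.coverInclusive T hT with h | ⟨T', hT', h⟩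
    · have := h _ hc₀
      rw [down_layerBox_succ, Box.IsUnder] at this
      simp [layerBox] at this
      omega
    · intro c hc
      have h1 := h (Finset.mem_image_of_mem _ hc₀)
      rw [down_layerBox_succ] at h1
      have h2 := ih hT' h1 _ (h (Finset.mem_image_of_mem _ hc))
      obtain ⟨-, k', hk'⟩ := exists_layerBox (hsub hT hc) hD.below.1
      rw [← hk'] at h2 ⊢
      simp only [Box.down, layerBox, Prod.mk.injEq, true_and] at h2 ⊢
      push_cast
      omega

/-- Since the tile stays in one layer, its Dyck path copies the steps of the lower path, and the
Dyck property becomes the excursion property. -/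
theorem IsCoverInclusive.exists_layerTile {l m : DyckWord} {D : Finset (Finset Box)}
    (hD : IsCoverInclusive l m D) {T : Finset Box} (hT : T ∈ D) :
    ∃ k a b, b ≤ 2 * l.semilength ∧ IsExcursion (height l) a b ∧
      T = layerTile (height l) k a b := by
  obtain ⟨k, hk⟩ := hD.exists_layer hT
  have hsub {c : Box} (hc : c ∈ T) : c ∈ skewShape l m :=
    hD.union_eq ▸ Finset.mem_biUnion.2 ⟨T, hT, hc⟩
  obtain ⟨c, p, rfl⟩ := hD.isDyckTile T hT
  have key (i : ℕ) (hi : i ≤ 2 * p.semilength) :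
      height l (c.1 + i) + 1 + 2 * k = c.2 + height p i ∧ c.1 + i ≤ 2 * l.semilength := by
    have hmem : (c.1 + i, c.2 + height p i) ∈ ribbon c p :=
      Finset.mem_image.2 ⟨i, by simpa [Nat.lt_succ_iff] using hi, rfl⟩
    have h1 := hk _ hmem
    simp only [layerBox, Prod.mk.injEq, true_and] at h1
    exact ⟨h1.symm, (exists_layerBox (hsub hmem) hD.below.1).1⟩
  have h0 := (key 0 (by omega)).1
  rw [height_zero_right, add_zero] at h0
  refine ⟨k, c.1, c.1 + 2 * p.semilength, (key _ le_rfl).2, ⟨by omega, ?_, ?_⟩, ?_⟩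
  · have := (key _ le_rfl).1
    rw [height_of_le le_rfl] at this
    omega
  · intro x h1 h2
    have := (key (x - c.1) (by omega)).1
    rw [show c.1 + (x - c.1) = x by omega] at this
    have := height_nonneg p (x - c.1)
    omega
  · ext d
    simp only [mem_layerTile, ribbon, Finset.mem_image, Finset.mem_range]
    constructor
    · rintro ⟨i, hi, rfl⟩
      refine ⟨c.1 + i, by omega, by omega, ?_⟩
      simp only [layerBox, (key i (by omega)).1]
    · rintro ⟨x, h1, h2, rfl⟩
      refine ⟨x - c.1, by omega, ?_⟩
      have := (key (x - c.1) (by omega)).1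
      rw [show c.1 + (x - c.1) = x by omega] at this ⊢
      simp only [layerBox, this]

end Tile

/-! ### Tilings correspond to closed labellings -/

section Encoding

variable {H : ℕ → ℤ} {h l : ℕ → ℕ}

/-- The numbers `h x` of boxes in column `x` and the numbers `l x` of tiles containing boxes of both
columns `x` and `x + 1`, for a cover-inclusive tiling above a path of length `2 * n` with
heights `H`. -/
structure IsClosedLabelling (H : ℕ → ℤ) (n : ℕ) (h l : ℕ → ℕ) : Prop where
  first : h 0 = 0
  last : ∀ x, 2 * n ≤ x → h x = 0
  up : ∀ x, x < 2 * n → H (x + 1) = H x + 1 → h (x + 1) ≤ h x ∧ h x ≤ h (x + 1) + 1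
  down : ∀ x, x < 2 * n → H (x + 1) = H x - 1 → h x ≤ h (x + 1) ∧ h (x + 1) ≤ h x + 1
  le : ∀ x, l x ≤ h x ∧ l x ≤ h (x + 1)
  closed : ∀ x, 0 < l x → ∃ a b, a ≤ x ∧ x < b ∧ b ≤ 2 * n ∧ IsExcursion H a b ∧
    ∀ z, a ≤ z → z < b → l x ≤ l z

/-- The columns from `a` to `b` are those of a tile in the layer `k`. -/
structure IsComponent (h l : ℕ → ℕ) (k a b : ℕ) : Prop where
  le : a ≤ b
  lt_height : k < h a
  joint : ∀ x, a ≤ x → x < b → k < l x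
  right : l b ≤ k
  left : ∀ x, x + 1 = a → l x ≤ k

theorem IsComponent.eq_of_mem {k a b a' b' x : ℕ} (h₁ : IsComponent h l k a b)
    (h₂ : IsComponent h l k a' b') (hx : a ≤ x ∧ x ≤ b) (hx' : a' ≤ x ∧ x ≤ b') :
    a = a' ∧ b = b' := by
  constructor
  · rcases lt_trichotomy a a' with hlt | rfl | hlt
    · have := h₁.joint (a' - 1) (by omega) (by omega)
      have := h₂.left (a' - 1) (by omega)
      omega
    · rfl
    · have := h₂.joint (a - 1) (by omega) (by omega)
      have := h₁.left (a - 1) (by omega)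
      omega
  · rcases lt_trichotomy b b' with hlt | rfl | hlt
    · have := h₂.joint b (by omega) (by omega)
      have := h₁.right
      omega
    · rfl
    · have := h₁.joint b' (by omega) (by omega)
      have := h₂.right
      omega

theorem IsComponent.lt_height_of_mem {k a b x : ℕ} (hc : IsComponent h l k a b)
    (hl : ∀ x, l x ≤ h x ∧ l x ≤ h (x + 1)) (ha : a ≤ x) (hb : x ≤ b) : k < h x := by
  rcases ha.eq_or_lt with rfl | ha
  · exact hc.lt_height
  · have h1 := hc.joint (x - 1) (by omega) (by omega)
    have h2 := (hl (x - 1)).2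
    rw [show x - 1 + 1 = x by omega] at h2
    omega

theorem exists_isComponent (hl : ∀ x, l x ≤ h x ∧ l x ≤ h (x + 1)) {n : ℕ}
    (hn : ∀ x, n ≤ x → h x = 0) {k x : ℕ} (hx : k < h x) :
    ∃ a b, a ≤ x ∧ x ≤ b ∧ IsComponent h l k a b := by
  classical
  have hex : ∃ b, x ≤ b ∧ l b ≤ k := ⟨x + n, by omega, by
    have := (hl (x + n)).1; have := hn (x + n) (by omega); omega⟩
  have hex' : ∃ a, a ≤ x ∧ ∀ z, a ≤ z → z < x → k < l z := ⟨x, le_rfl, by omega⟩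
  have hb := Nat.find_spec hex
  have ha := Nat.find_spec hex'
  have hb' : ∀ z, x ≤ z → z < Nat.find hex → k < l z := fun z h1 h2 => by
    have := Nat.find_min hex h2
    by_contra h3
    exact this ⟨h1, by omega⟩
  refine ⟨Nat.find hex', Nat.find hex, ha.1, hb.1, ha.1.trans hb.1, ?_, ?_, hb.2, ?_⟩
  · rcases ha.1.eq_or_lt with h1 | h1
    · rwa [h1]
    · exact (ha.2 _ le_rfl h1).trans_le (hl _).1
  · intro z h1 h2
    rcases lt_or_ge z x with h3 | h3
    · exact ha.2 z h1 h3
    · exact hb' z h3 h2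
  · intro z hz
    by_contra h1
    refine Nat.find_min hex' (m := z) (by omega) ⟨by omega, fun y h2 h3 => ?_⟩
    rcases h2.eq_or_lt with rfl | h2
    · omega
    · exact ha.2 y (by omega) h3

/-- Every joint of the component lies in an excursion, which maximality keeps inside the component.
Chaining these excursions from the left end bounds all heights below by `H a`, chaining from the
right end by `H b`; hence the two are equal. -/
theorem IsClosedLabelling.isExcursion {n : ℕ} (hl : IsClosedLabelling H n h l) {k a b : ℕ}
    (hc : IsComponent h l k a b) : IsExcursion H a b := by
  have hle := hc.le
  have key (x : ℕ) (h1 : a ≤ x) (h2 : x < b) : ∃ a' b', a ≤ a' ∧ a' ≤ x ∧ x < b' ∧ b' ≤ b ∧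
      IsExcursion H a' b' := by
    have hx := hc.joint x h1 h2
    obtain ⟨a', b', h3, h4, -, h5, h6⟩ := hl.closed x (by omega)
    refine ⟨a', b', ?_, h3, h4, ?_, h5⟩
    · by_contra h7
      have := hc.left (a - 1) (by omega)
      have := h6 (a - 1) (by omega) (by omega)
      omega
    · by_contra h7
      have := hc.right
      have := h6 b (by omega) (by omega)
      omega
  have left (x : ℕ) (h1 : a ≤ x) (h2 : x ≤ b) : H a ≤ H x := by
    induction x using Nat.strong_induction_on with
    | _ x ih =>
      rcases h1.eq_or_lt with rfl | h1
      · rfl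
      · obtain ⟨a', b', h3, h4, h5, h6, h7⟩ := key (x - 1) (by omega) (by omega)
        exact (ih a' (by omega) h3 (by omega)).trans (h7.ge x (by omega) (by omega))
  have right (y x : ℕ) (h0 : x + y = b) (h1 : a ≤ x) : H b ≤ H x := by
    induction y using Nat.strong_induction_on generalizing x with
    | _ y ih =>
      rcases y.eq_zero_or_pos with rfl | h2
      · rw [← h0]; rfl
      · obtain ⟨a', b', h3, h4, h5, h6, h7⟩ := key x (by omega) (by omega)
        have := ih (b - b') (by omega) b' (by omega) (by omega)
        have := h7.ge x (by omega) (by omega)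
        have := h7.eq
        omega
  exact ⟨hle, le_antisymm (left b hle le_rfl) (right (b - a) a (by omega) le_rfl), left⟩

/-- The labelling `h`, `l` consists of the column sizes and joint numbers of the tiling `D`. -/
structure Encodes (H : ℕ → ℤ) (D : Finset (Finset Box)) (h l : ℕ → ℕ) : Prop where
  exists_mem : ∀ x k, (∃ T ∈ D, layerBox H x k ∈ T) ↔ k < h x
  exists_joint : ∀ x k,
    (∃ T ∈ D, layerBox H x k ∈ T ∧ layerBox H (x + 1) k ∈ T) ↔ k < l x
  mem_iff : ∀ T, T ∈ D ↔ ∃ k a b, IsComponent h l k a b ∧ T = layerTile H k a b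

theorem Encodes.label_unique {D : Finset (Finset Box)} {h' l' : ℕ → ℕ} (h₁ : Encodes H D h l)
    (h₂ : Encodes H D h' l') : h = h' ∧ l = l' := by
  have aux {m n : ℕ} (hmn : ∀ k, k < m ↔ k < n) : m = n := by
    have := hmn m; have := hmn n; omega
  exact ⟨funext fun x => aux fun k => (h₁.exists_mem x k).symm.trans (h₂.exists_mem x k),
    funext fun x => aux fun k => (h₁.exists_joint x k).symm.trans (h₂.exists_joint x k)⟩

theorem Encodes.tiling_unique {D D' : Finset (Finset Box)} (h₁ : Encodes H D h l)
    (h₂ : Encodes H D' h l) : D = D' := by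
  ext T
  rw [h₁.mem_iff, h₂.mem_iff]

theorem exists_forall_iff_lt {P : ℕ → Prop} (hP : ∀ k, P (k + 1) → P k) {B : ℕ}
    (hB : ∀ k, P k → k < B) : ∃ c, ∀ k, P k ↔ k < c := by
  classical
  have hex : ∃ k, ¬ P k := ⟨B, fun h => (hB B h).false⟩
  refine ⟨Nat.find hex, fun k => ⟨fun hk => ?_, fun hk => by simpa using Nat.find_min hex hk⟩⟩
  by_contra hlt
  have key (j : ℕ) : ¬ P (Nat.find hex + j) := by
    induction j with
    | zero => exact Nat.find_spec hex
    | succ j ih => exact fun h => ih (hP _ h)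
  exact key (k - Nat.find hex) (by rwa [show Nat.find hex + (k - Nat.find hex) = k by omega])

/-- By cover-inclusivity the layers having a joint at a given column are closed downwards, so they
are described by their number. The conditions on `h` hold because both paths change by `±1` at each
step and differ by `2 * h`. -/
theorem IsCoverInclusive.exists_encodes {w m : DyckWord} {D : Finset (Finset Box)}
    (hD : IsCoverInclusive w m D) :
    ∃ h l, IsClosedLabelling (height w) w.semilength h l ∧ Encodes (height w) D h l := by
  set H := height w with hH
  have hex {x k : ℕ} : (∃ T ∈ D, layerBox H x k ∈ T) ↔ layerBox H x k ∈ skewShape w m := by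
    rw [← hD.union_eq, Finset.mem_biUnion]; rfl
  have hh (x : ℕ) : ∃ h : ℕ, height m x = H x + 2 * h := by
    have hx := hD.below.2 x
    rcases le_or_gt x (2 * w.semilength) with h1 | h1
    · obtain ⟨r, hr⟩ := even_height_add h1
      obtain ⟨r', hr'⟩ := even_height_add (w := m) (x := x) (hD.below.1 ▸ h1)
      exact ⟨((height m x - H x) / 2).toNat, by rw [hH]; omega⟩
    · refine ⟨0, ?_⟩
      rw [hH, height_of_le h1.le, height_of_le (hD.below.1 ▸ h1.le)]
      rfl
  choose h hh using hh
  have hmem (x k : ℕ) : (∃ T ∈ D, layerBox H x k ∈ T) ↔ k < h x := by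
    rw [hex]
    rcases le_or_gt x (2 * w.semilength) with h1 | h1
    · exact layerBox_mem_skewShape h1 (hh x)
    · constructor
      · intro h2
        have := (exists_layerBox h2 hD.below.1).1
        exact absurd this (by simp only [layerBox]; omega)
      · have h2 := height_of_le (w := w) h1.le
        have h3 := height_of_le (w := m) (hD.below.1 ▸ h1.le)
        have := hh x
        rw [hH] at this
        omega
  have hdown (x k : ℕ) (hP : ∃ T ∈ D, layerBox H x (k + 1) ∈ T ∧ layerBox H (x + 1) (k + 1) ∈ T) :
      ∃ T ∈ D, layerBox H x k ∈ T ∧ layerBox H (x + 1) k ∈ T := by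
    obtain ⟨T, hT, h1, h2⟩ := hP
    rcases hD.coverInclusive T hT with h3 | ⟨T', hT', h3⟩
    · have := h3 _ h1
      rw [down_layerBox_succ, Box.IsUnder] at this
      simp only [layerBox, hH] at this
      omega
    · refine ⟨T', hT', ?_, ?_⟩
      · rw [← down_layerBox_succ]; exact h3 (Finset.mem_image_of_mem _ h1)
      · rw [← down_layerBox_succ]; exact h3 (Finset.mem_image_of_mem _ h2)
  choose l hl using fun x => exists_forall_iff_lt
    (P := fun k => ∃ T ∈ D, layerBox H x k ∈ T ∧ layerBox H (x + 1) k ∈ T) (hdown x)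
    (fun k ⟨T, hT, h1, _⟩ => (hmem x k).1 ⟨T, hT, h1⟩)
  have hle (x : ℕ) : l x ≤ h x ∧ l x ≤ h (x + 1) := by
    constructor <;> by_contra h1
    · obtain ⟨T, hT, h2, h3⟩ := (hl x (h x)).2 (by omega)
      exact ((hmem x _).1 ⟨T, hT, h2⟩).false
    · obtain ⟨T, hT, h2, h3⟩ := (hl x (h (x + 1))).2 (by omega)
      exact ((hmem (x + 1) _).1 ⟨T, hT, h3⟩).false
  have hcomp {k a b : ℕ} (hab : a ≤ b) (hT : layerTile H k a b ∈ D) : IsComponent h l k a b :=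
    { le := hab
      lt_height := (hmem a k).1 ⟨_, hT, layerBox_mem_layerTile.2 ⟨rfl, le_rfl, hab⟩⟩
      joint x h1 h2 := (hl x k).1 ⟨_, hT, layerBox_mem_layerTile.2 ⟨rfl, h1, h2.le⟩,
        layerBox_mem_layerTile.2 ⟨rfl, by omega, h2⟩⟩
      right := by
        by_contra h1
        obtain ⟨T, hT', h2, h3⟩ := (hl b k).2 (by omega)
        obtain rfl := hD.disjoint.elim_finset hT' hT _ h2
          (layerBox_mem_layerTile.2 ⟨rfl, hab, le_rfl⟩)
        have := layerBox_mem_layerTile.1 h3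
        omega
      left := by
        rintro x rfl
        by_contra h1
        obtain ⟨T, hT', h2, h3⟩ := (hl x k).2 (by omega)
        obtain rfl := hD.disjoint.elim_finset hT' hT _ h3
          (layerBox_mem_layerTile.2 ⟨rfl, le_rfl, hab⟩)
        have := layerBox_mem_layerTile.1 h2
        omega }
  refine ⟨h, l, ⟨?_, ?_, ?_, ?_, hle, ?_⟩, hmem, hl, fun T => ⟨fun hT => ?_, ?_⟩⟩
  · have := hh 0
    simp [hH] at this
    omega
  · intro x hx
    have h2 := height_of_le (w := w) hx
    have h3 := height_of_le (w := m) (hD.below.1 ▸ hx)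
    have := hh x
    rw [h3, hH, h2] at this
    omega
  · intro x hx h1
    have h2 := height_succ (w := m) (x := x) (hD.below.1 ▸ hx)
    have := hh x
    have := hh (x + 1)
    omega
  · intro x hx h1
    have h2 := height_succ (w := m) (x := x) (hD.below.1 ▸ hx)
    have := hh x
    have := hh (x + 1)
    omega
  · intro x hx
    -- The tile of the topmost joint at `x` supplies the excursion: each of its joints is in layer
    -- `l x - 1`.
    obtain ⟨T, hT, h1, h2⟩ := (hl x (l x - 1)).2 (by omega)
    obtain ⟨k, a, b, hb, hab, rfl⟩ := hD.exists_layerTile hT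
    obtain ⟨rfl, h3, h4⟩ := layerBox_mem_layerTile.1 h1
    obtain ⟨-, h5, h6⟩ := layerBox_mem_layerTile.1 h2
    refine ⟨a, b, h3, h6, hb, hab, fun z h7 h8 => ?_⟩
    have := (hcomp hab.le hT).joint z h7 h8
    omega
  · obtain ⟨k, a, b, hb, hab, rfl⟩ := hD.exists_layerTile hT
    exact ⟨k, a, b, hcomp hab.le hT, rfl⟩
  · rintro ⟨k, a, b, hc, rfl⟩
    obtain ⟨T, hT, h1⟩ := (hmem a k).2 hc.lt_height
    obtain ⟨k', a', b', hb, hab, rfl⟩ := hD.exists_layerTile hT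
    obtain ⟨rfl, h3, h4⟩ := layerBox_mem_layerTile.1 h1
    obtain ⟨rfl, rfl⟩ := hc.eq_of_mem (hcomp hab.le hT) ⟨le_rfl, hc.le⟩ ⟨h3, h4⟩
    exact hT

theorem IsClosedLabelling.exists_upper {w : DyckWord}
    (hl : IsClosedLabelling (height w) w.semilength h l) :
    ∃ m, IsBelow w m ∧ ∀ x, height m x = height w x + 2 * h x := by
  obtain ⟨m, hm, hm'⟩ := exists_height_eq (n := w.semilength)
    (g := fun x => height w x + 2 * h x) (by simp [hl.first])
    (by rw [hl.last _ le_rfl, height_of_le le_rfl]; rfl)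
    (fun x _ => by have := height_nonneg w x; positivity)
    (fun x hx => by
      have := hl.up x hx
      have := hl.down x hx
      have := height_succ hx
      omega)
  have key (x : ℕ) : height m x = height w x + 2 * h x := by
    rcases le_or_gt x (2 * w.semilength) with h1 | h1
    · exact hm' x h1
    · rw [height_of_le h1.le, height_of_le (hm ▸ h1.le), hl.last x h1.le]
      rfl
  exact ⟨m, ⟨hm.symm, fun i => by have := key i; omega⟩, key⟩

/-- The tiles are all components of all layers. Cover-inclusivity holds because a joint with `k + 1
< l x` also has `k < l x`, so a component of layer `k + 1` sits above a single component of layer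
`k`. -/
theorem IsClosedLabelling.exists_tiling {w : DyckWord}
    (hl : IsClosedLabelling (height w) w.semilength h l) :
    ∃ m D, IsCoverInclusive w m D ∧ Encodes (height w) D h l := by
  classical
  obtain ⟨m, hm, hm'⟩ := hl.exists_upper
  set H := height w with hH
  have hlen {x k : ℕ} (hk : k < h x) : x ≤ 2 * w.semilength := by
    by_contra h1
    have := hl.last x (by omega)
    omega
  have hsub {k a b : ℕ} (hc : IsComponent h l k a b) : layerTile H k a b ⊆ skewShape w m := by
    intro c hmem
    obtain ⟨x, h1, h2, rfl⟩ := mem_layerTile.1 hmem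
    have h3 := hc.lt_height_of_mem hl.le h1 h2
    exact (layerBox_mem_skewShape (hlen h3) (hm' x)).2 h3
  let D := (skewShape w m).powerset.filter fun T =>
    ∃ k a b, IsComponent h l k a b ∧ T = layerTile H k a b
  have hD (T) : T ∈ D ↔ ∃ k a b, IsComponent h l k a b ∧ T = layerTile H k a b := by
    simp only [D, Finset.mem_filter, Finset.mem_powerset, and_iff_right_iff_imp]
    rintro ⟨k, a, b, hc, rfl⟩
    exact hsub hc
  refine ⟨m, D, ⟨hm, fun T hT => ?_, fun T hT T' hT' hne => ?_, ?_, fun T hT => ?_⟩,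
    fun x k => ⟨?_, fun hk => ?_⟩, fun x k => ⟨?_, fun hk => ?_⟩, hD⟩
  · obtain ⟨k, a, b, hc, rfl⟩ := (hD T).1 hT
    exact isDyckTile_layerTile (hlen (hc.lt_height_of_mem hl.le hc.le le_rfl))
      (hl.isExcursion hc)
  · obtain ⟨k, a, b, hc, rfl⟩ := (hD T).1 hT
    obtain ⟨k', a', b', hc', rfl⟩ := (hD T').1 hT'
    refine Finset.disjoint_left.2 fun c h1 h2 => hne ?_
    obtain ⟨x, h3, h4, rfl⟩ := mem_layerTile.1 h1
    obtain ⟨rfl, h5, h6⟩ := layerBox_mem_layerTile.1 h2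
    obtain ⟨rfl, rfl⟩ := hc.eq_of_mem hc' ⟨h3, h4⟩ ⟨h5, h6⟩
    rfl
  · ext c
    simp only [Finset.mem_biUnion, id]
    constructor
    · rintro ⟨T, hT, hc⟩
      obtain ⟨k, a, b, hab, rfl⟩ := (hD T).1 hT
      exact hsub hab hc
    · intro hc
      obtain ⟨h1, k, hk⟩ := exists_layerBox hc hm.1
      rw [← hk] at hc ⊢
      obtain ⟨a, b, h2, h3, h4⟩ := exists_isComponent hl.le hl.last
        ((layerBox_mem_skewShape h1 (hm' _)).1 hc)
      exact ⟨_, (hD _).2 ⟨k, a, b, h4, rfl⟩, layerBox_mem_layerTile.2 ⟨rfl, h2, h3⟩⟩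
  · obtain ⟨k, a, b, hc, rfl⟩ := (hD T).1 hT
    cases k with
    | zero =>
      left
      intro c hmem
      obtain ⟨x, h1, h2, rfl⟩ := mem_layerTile.1 hmem
      simp only [Box.IsUnder, Box.down, layerBox, hH]
      omega
    | succ k =>
      right
      obtain ⟨a', b', h2, h3, h4⟩ := exists_isComponent hl.le hl.last
        (show k < h a from (Nat.lt_succ_self k).trans hc.lt_height)
      refine ⟨_, (hD _).2 ⟨k, a', b', h4, rfl⟩, ?_⟩
      intro c hmem
      obtain ⟨d, hd, rfl⟩ := Finset.mem_image.1 hmem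
      obtain ⟨x, h5, h6, rfl⟩ := mem_layerTile.1 hd
      rw [down_layerBox_succ, layerBox_mem_layerTile]
      refine ⟨rfl, by omega, ?_⟩
      by_contra h7
      have := hc.joint b' (by omega) (by omega)
      have := h4.right
      omega
  · rintro ⟨T, hT, hx⟩
    obtain ⟨k', a, b, hc, rfl⟩ := (hD T).1 hT
    obtain ⟨rfl, h1, h2⟩ := layerBox_mem_layerTile.1 hx
    exact hc.lt_height_of_mem hl.le h1 h2
  · obtain ⟨a, b, h2, h3, h4⟩ := exists_isComponent hl.le hl.last hk
    exact ⟨_, (hD _).2 ⟨k, a, b, h4, rfl⟩, layerBox_mem_layerTile.2 ⟨rfl, h2, h3⟩⟩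
  · rintro ⟨T, hT, hx, hx'⟩
    obtain ⟨k', a, b, hc, rfl⟩ := (hD T).1 hT
    obtain ⟨rfl, h1, h2⟩ := layerBox_mem_layerTile.1 hx
    obtain ⟨-, h3, h4⟩ := layerBox_mem_layerTile.1 hx'
    exact hc.joint x h1 h4
  · obtain ⟨a, b, h2, h3, h4⟩ := exists_isComponent hl.le hl.last (hk.trans_le (hl.le x).1)
    have : x < b := by
      by_contra h5
      obtain rfl : x = b := by omega
      have := h4.right
      omega
    exact ⟨_, (hD _).2 ⟨k, a, b, h4, rfl⟩, layerBox_mem_layerTile.2 ⟨rfl, h2, h3⟩,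
      layerBox_mem_layerTile.2 ⟨rfl, by omega, this⟩⟩

/-- The statistic `art` in terms of the labelling. -/
theorem two_mul_art_add {w m : DyckWord} {D : Finset (Finset Box)} (hD : IsCoverInclusive w m D)
    (hl : IsClosedLabelling (height w) w.semilength h l) (he : Encodes (height w) D h l) :
    2 * art D + ∑ x ∈ Finset.range (2 * w.semilength), l x =
      2 * ∑ x ∈ Finset.range (2 * w.semilength + 1), h x := by
  classical
  set N := 2 * w.semilength
  have hN {x : ℕ} {k : ℕ} (hk : k < h x) : x < N + 1 := by
    by_contra h1
    have := hl.last x (by omega)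
    omega
  have harea : area D = ∑ x ∈ Finset.range (N + 1), h x := by
    have : D.biUnion id = ((Finset.range (N + 1)).sigma fun x => Finset.range (h x)).image
        fun p => layerBox (height w) p.1 p.2 := by
      ext c
      simp only [Finset.mem_image, Finset.mem_sigma, Finset.mem_range, Sigma.exists]
      constructor
      · intro hc
        obtain ⟨h1, k, hk⟩ := exists_layerBox (hD.union_eq ▸ hc) hD.below.1
        rw [Finset.mem_biUnion] at hc
        rw [← hk] at hc
        have := (he.exists_mem c.1 k).1 hc
        exact ⟨c.1, k, ⟨hN this, this⟩, hk⟩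
      · rintro ⟨x, k, ⟨-, hk⟩, rfl⟩
        exact Finset.mem_biUnion.2 ((he.exists_mem x k).2 hk)
    rw [area, this, Finset.card_image_of_injOn, Finset.card_sigma]
    · simp
    · rintro ⟨x, k⟩ - ⟨x', k'⟩ - heq
      obtain ⟨rfl, rfl⟩ := layerBox_inj.1 heq
      rfl
  have htiles : tiles D = ∑ x ∈ Finset.range (N + 1), (h x - l x) := by
    -- Tiles are counted by their right ends: the tile in layer `k` of column `x` ends there exactly
    -- when `l x ≤ k`.
    have hP (p : (_ : ℕ) × ℕ) (hp : p ∈ (Finset.range (N + 1)).sigma fun x =>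
        Finset.Ico (l x) (h x)) : ∃ a, IsComponent h l p.2 a p.1 := by
      simp only [Finset.mem_sigma, Finset.mem_Ico] at hp
      obtain ⟨a, b, h1, h2, h3⟩ := exists_isComponent hl.le hl.last hp.2.2
      obtain rfl : p.1 = b := by
        by_contra h4
        have := h3.joint p.1 h1 (by omega)
        omega
      exact ⟨a, h3⟩
    choose a ha using hP
    have hcard : ∑ x ∈ Finset.range (N + 1), (h x - l x) =
        ((Finset.range (N + 1)).sigma fun x => Finset.Ico (l x) (h x)).card := by
      simp
    rw [tiles, hcard]
    symm
    refine Finset.card_bij (fun p hp => layerTile (height w) p.2 (a p hp) p.1) ?_ ?_ ?_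
    · intro p hp
      exact (he.mem_iff _).2 ⟨_, _, _, ha p hp, rfl⟩
    · intro p hp p' hp' heq
      obtain ⟨h1, -, h2⟩ := layerTile_inj (ha p hp).le (ha p' hp').le heq
      exact Sigma.ext h2 (heq_of_eq h1)
    · intro T hT
      obtain ⟨k, a', b, hc, rfl⟩ := (he.mem_iff T).1 hT
      have h1 := hc.lt_height_of_mem hl.le hc.le le_rfl
      have hp : (⟨b, k⟩ : (_ : ℕ) × ℕ) ∈ (Finset.range (N + 1)).sigma fun x =>
          Finset.Ico (l x) (h x) := by
        have := hN h1
        have := hc.right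
        simp only [Finset.mem_sigma, Finset.mem_range, Finset.mem_Ico]
        omega
      refine ⟨⟨b, k⟩, hp, ?_⟩
      have h2 := ha _ hp
      rw [(h2.eq_of_mem hc ⟨h2.le, le_rfl⟩ ⟨hc.le, le_rfl⟩).1]
  have hlast : l N = 0 := by
    have := (hl.le N).1
    have := hl.last N le_rfl
    omega
  have hsum : ∑ x ∈ Finset.range N, l x = ∑ x ∈ Finset.range (N + 1), l x := by
    rw [Finset.sum_range_succ, hlast, add_zero]
  rw [two_mul_art hD, harea, htiles, hsum, add_assoc, ← Finset.sum_add_distrib,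
    Finset.sum_congr rfl fun x _ => Nat.sub_add_cancel (hl.le x).1, two_mul]

end Encoding

/-! ### Closed labellings as valid labellings of the tree -/

section Shape

theorem height_nest_add_succ (p r : DyckWord) {x : ℕ} (hx : x ≤ 2 * p.semilength) :
    height (p.nest + r) (x + 1) = height p x + 1 := by
  rw [p.two_mul_semilength_eq_length] at hx
  have h : (p.nest + r).toList = DyckStep.U :: (p.toList ++ ([DyckStep.D] ++ r.toList)) := by
    change (DyckStep.U :: p.toList ++ [DyckStep.D]) ++ r.toList = _
    simp
  rw [height, height, h, List.take_succ_cons, List.take_append_of_le_length hx]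
  simp
  ring

theorem height_nest_add_add (p r : DyckWord) (x : ℕ) :
    height (p.nest + r) (2 * p.semilength + 2 + x) = height r x := by
  have hp := p.two_mul_semilength_eq_length
  have h : (p.nest + r).toList = p.nest.toList ++ r.toList := rfl
  have hlen : p.nest.toList.length = 2 * p.semilength + 2 := by
    rw [← p.nest.two_mul_semilength_eq_length, DyckWord.semilength_nest]; ring
  have := p.nest.count_U_eq_count_D
  rw [height, height, h, ← hlen, List.take_length_add_append, List.count_append,
    List.count_append]
  omega

/-- From column `s` on, the heights `H` are those of the path encoded by the tree. -/
def Follows (H : ℕ → ℤ) : BinaryTree Unit → ℕ → Prop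
  | .nil, _ => True
  | .node _ p r, s => H (s + 1) = H s + 1 ∧
    H (s + 2 * p.numNodes + 2) = H (s + 2 * p.numNodes + 1) - 1 ∧
    Follows H p (s + 1) ∧ Follows H r (s + 2 * p.numNodes + 2)

theorem semilength_ofTree (t : BinaryTree Unit) : (DyckWord.ofTree t).semilength = t.numNodes := by
  rw [← DyckWord.numNodes_toTree, DyckWord.toTree_ofTree]

theorem follows_of_eq {H : ℕ → ℤ} {t : BinaryTree Unit} {s : ℕ}
    (h : ∀ x, x ≤ 2 * t.numNodes → H (s + x) = H s + height (DyckWord.ofTree t) x) :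
    Follows H t s := by
  induction t generalizing s with
  | nil => trivial
  | node _ p r ihp ihr =>
    have hp := semilength_ofTree p
    rw [BinaryTree.numNodes, DyckWord.ofTree] at h
    have h1 (x : ℕ) (hx : x ≤ 2 * p.numNodes) :
        H (s + 1 + x) = H s + 1 + height (DyckWord.ofTree p) x := by
      rw [add_assoc s, add_comm 1, h (x + 1) (by omega),
        height_nest_add_succ _ _ (hp.symm ▸ hx)]
      ring
    have h2 (x : ℕ) (hx : x ≤ 2 * r.numNodes) :
        H (s + 2 * p.numNodes + 2 + x) = H s + height (DyckWord.ofTree r) x := by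
      have := height_nest_add_add (DyckWord.ofTree p) (DyckWord.ofTree r) x
      rw [hp] at this
      rw [← this, ← h _ (by omega)]
      congr 1
      ring
    have h3 := h1 0 (by omega)
    have h4 := h2 0 (by omega)
    have h5 := h1 (2 * p.numNodes) le_rfl
    rw [height_zero_right, add_zero, add_zero] at h3 h4
    rw [height_of_le (by rw [hp]), show s + 1 + 2 * p.numNodes = s + 2 * p.numNodes + 1 by ring]
      at h5
    refine ⟨h3, by omega, ihp fun x hx => ?_, ihr fun x hx => ?_⟩
    · rw [h1 x hx, h3]
    · rw [h2 x hx, h4]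

theorem Follows.last_eq {H : ℕ → ℤ} {t : BinaryTree Unit} {s : ℕ} (hf : Follows H t s) :
    H (s + 2 * t.numNodes) = H s := by
  induction t generalizing s with
  | nil => rfl
  | node _ p r ihp ihr =>
    obtain ⟨h1, h2, h3, h4⟩ := hf
    have h5 := ihp h3
    have h6 := ihr h4
    rw [show s + 1 + 2 * p.numNodes = s + 2 * p.numNodes + 1 by ring] at h5
    rw [BinaryTree.numNodes,
      show s + 2 * (p.numNodes + r.numNodes + 1) = s + 2 * p.numNodes + 2 + 2 * r.numNodes by ring]
    omega

theorem Follows.le {H : ℕ → ℤ} {t : BinaryTree Unit} {s : ℕ} (hf : Follows H t s) (x : ℕ)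
    (h1 : s ≤ x) (h2 : x ≤ s + 2 * t.numNodes) : H s ≤ H x := by
  induction t generalizing s with
  | nil =>
    obtain rfl : s = x := by simp at h2; omega
    rfl
  | node _ p r ihp ihr =>
    rw [BinaryTree.numNodes] at h2
    have hl := hf.2.2.1.last_eq
    rw [show s + 1 + 2 * p.numNodes = s + 2 * p.numNodes + 1 by ring] at hl
    obtain ⟨h3, h4, h5, h6⟩ := hf
    rcases h1.eq_or_lt with rfl | h1
    · rfl
    · rcases lt_or_ge x (s + 2 * p.numNodes + 2) with h7 | h7
      · have := ihp h5 (by omega) (by omega)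
        omega
      · have := ihr h6 h7 (by omega)
        omega

theorem Follows.isExcursion {H : ℕ → ℤ} {p r : BinaryTree Unit} {s : ℕ}
    (hf : Follows H (.node () p r) s) : IsExcursion H s (s + 2 * p.numNodes + 2) := by
  -- Dropping the part after the first return makes the arch a whole path, to which the general
  -- bounds apply.
  have hf' : Follows H (.node () p .nil) s := ⟨hf.1, hf.2.1, hf.2.2.1, trivial⟩
  exact ⟨by omega, hf'.last_eq.symm, fun x h1 h2 => hf'.le x h1 h2⟩

variable {H : ℕ → ℤ} {h l : ℕ → ℕ}

theorem Valid.le_joint {t : BinaryTree Unit} {s b : ℕ} (hv : Valid h l t s b) (x : ℕ) (h1 : s ≤ x)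
    (h2 : x < s + 2 * t.numNodes) : b ≤ l x := by
  induction t generalizing s b with
  | nil => simp at h2; omega
  | node _ p r ihp ihr =>
    rw [BinaryTree.numNodes] at h2
    obtain ⟨h3, -, -, h4, h5⟩ := hv
    rcases h1.eq_or_lt with rfl | h1
    · exact h3.1
    · rcases lt_trichotomy x (s + 2 * p.numNodes + 1) with h6 | rfl | h6
      · exact h3.1.trans (ihp h4 (by omega) (by omega))
      · exact h3.2.2 ▸ h3.1
      · exact ihr h5 (by omega) (by omega)

/-- The conditions on a labelling at column `x`, with tiles between the columns `s` and `e`. -/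
structure IsClosedAt (H : ℕ → ℤ) (h l : ℕ → ℕ) (s e x : ℕ) : Prop where
  up : H (x + 1) = H x + 1 → h (x + 1) ≤ h x ∧ h x ≤ h (x + 1) + 1
  down : H (x + 1) = H x - 1 → h x ≤ h (x + 1) ∧ h (x + 1) ≤ h x + 1
  le : l x ≤ h x ∧ l x ≤ h (x + 1)
  closed : ∃ a b, s ≤ a ∧ a ≤ x ∧ x < b ∧ b ≤ e ∧ IsExcursion H a b ∧
    ∀ z, a ≤ z → z < b → l x ≤ l z

theorem IsClosedAt.mono {s e s' e' x : ℕ} (hx : IsClosedAt H h l s e x) (hs : s' ≤ s)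
    (he : e ≤ e') : IsClosedAt H h l s' e' x := by
  obtain ⟨h1, h2, h3, a, b, h4, h5, h6, h7, h8⟩ := hx
  exact ⟨h1, h2, h3, a, b, hs.trans h4, h5, h6, h7.trans he, h8⟩

theorem Valid.isClosedAt {t : BinaryTree Unit} {s b : ℕ} (hv : Valid h l t s b)
    (hf : Follows H t s) (x : ℕ) (h1 : s ≤ x) (h2 : x < s + 2 * t.numNodes) :
    IsClosedAt H h l s (s + 2 * t.numNodes) x := by
  induction t generalizing s b with
  | nil => simp at h2; omega
  | node _ p r ihp ihr =>
    have hexc := hf.isExcursion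
    rw [BinaryTree.numNodes] at h2 ⊢
    obtain ⟨⟨-, h3, h3'⟩, h4, h5, hp, hr⟩ := hv
    obtain ⟨h6, h7, hp', hr'⟩ := hf
    have hj (z : ℕ) (hz : s ≤ z) (hz' : z < s + 2 * p.numNodes + 2) : l s ≤ l z := by
      rcases hz.eq_or_lt with rfl | hz
      · rfl
      · rcases lt_or_ge z (s + 2 * p.numNodes + 1) with h8 | h8
        · exact hp.le_joint z (by omega) (by omega)
        · rw [show z = s + 2 * p.numNodes + 1 by omega, h3']
    have hfirst := hp.le_first
    have hlast := hp.le_last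
    rw [show s + 1 + 2 * p.numNodes = s + 2 * p.numNodes + 1 by ring] at hlast
    rcases h1.eq_or_lt with rfl | h1
    · exact ⟨fun _ => ⟨h4.2, h4.1⟩, fun h => by omega, ⟨h3, hfirst⟩, s, _, le_rfl, le_rfl,
        by omega, by omega, hexc, hj⟩
    · rcases lt_trichotomy x (s + 2 * p.numNodes + 1) with h8 | rfl | h8
      · exact (ihp hp hp' (by omega) (by omega)).mono (by omega) (by omega)
      · refine ⟨fun h => ?_, fun _ => h5, ?_, s, _, le_rfl, by omega, Nat.lt_succ_self _, by omega,
          hexc, fun z h9 h10 => h3'.symm ▸ hj z h9 h10⟩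
        · rw [h7] at h; omega
        · rw [h3']; exact ⟨hlast, hlast.trans h5.1⟩
      · exact (ihr hr hr' (by omega) (by omega)).mono (by omega) (by omega)

/-- An excursion cannot separate the two steps of an arch, since the path is strictly higher under
the arch than at its feet. So the excursion at either step contains the other, which makes their
joint numbers equal and a lower bound for those in between. -/
theorem valid_of_isClosedAt {t : BinaryTree Unit} {s b m n : ℕ} (hf : Follows H t s)
    (hx : ∀ x, s ≤ x → x < s + 2 * t.numNodes → IsClosedAt H h l m n x)
    (hb : b ≤ h s) (hb' : ∀ x, s ≤ x → x < s + 2 * t.numNodes → b ≤ l x) :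
    Valid h l t s b := by
  induction t generalizing s b with
  | nil => exact hb
  | node _ p r ihp ihr =>
    have hexc := hf.isExcursion
    rw [BinaryTree.numNodes] at hx hb'
    obtain ⟨h1, h2, hp, hr⟩ := hf
    have hs := hx s le_rfl (by omega)
    have he := hx (s + 2 * p.numNodes + 1) (by omega) (by omega)
    have hge (z : ℕ) (hz : s + 1 ≤ z) (hz' : z ≤ s + 2 * p.numNodes + 1) : H s < H z := by
      have := hp.le z hz (by omega)
      omega
    have heq := hexc.eq
    have hleft (z : ℕ) (hz : s ≤ z) (hz' : z < s + 2 * p.numNodes + 2) : l s ≤ l z := by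
      obtain ⟨a, c, -, h3, h4, -, h5, h6⟩ := hs.closed
      refine h6 z (by omega) ?_
      by_contra h7
      have := h5.ge s h3 h4.le
      have := h5.eq
      have := hge c (by omega) (by omega)
      omega
    have hright : l (s + 2 * p.numNodes + 1) ≤ l s := by
      obtain ⟨a, c, -, h3, h4, -, h5, h6⟩ := he.closed
      refine h6 s ?_ (by omega)
      by_contra h7
      have := h5.ge (s + 2 * p.numNodes + 2) (by omega) h4
      have := hge a (by omega) (by omega)
      omega
    refine ⟨⟨hb' s le_rfl (by omega), hs.le.1, le_antisymm hright (hleft _ (by omega) (by omega))⟩,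
      (hs.up h1).symm, he.down h2, ihp hp ?_ hs.le.2 ?_, ihr hr ?_ ?_ ?_⟩
    · exact fun x h3 h4 => hx x (by omega) (by omega)
    · exact fun x h3 h4 => hleft x (by omega) (by omega)
    · exact fun x h3 h4 => hx x (by omega) (by omega)
    · exact (hb' _ (by omega) (by omega)).trans he.le.2
    · exact fun x h3 h4 => hb' x (by omega) (by omega)

/-- Nodes and empty subtrees together account for each column once. A node subtracts the joint
number of its up step, which is half of what its two matched steps contribute to the sum of `l`. -/
theorem two_mul_labelWeight_add {t : BinaryTree Unit} {s b : ℕ} (hv : Valid h l t s b) :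
    2 * labelWeight h l t s + ∑ x ∈ Finset.Ico s (s + 2 * t.numNodes), l x =
      2 * ∑ x ∈ Finset.Ico s (s + 2 * t.numNodes + 1), h x := by
  induction t generalizing s b with
  | nil => simp [labelWeight]
  | node _ p r ihp ihr =>
    obtain ⟨⟨-, h1, h2⟩, -, -, hp, hr⟩ := hv
    have h3 := ihp hp
    have h4 := ihr hr
    rw [show s + 1 + 2 * p.numNodes = s + 2 * p.numNodes + 1 by ring,
      show s + 2 * p.numNodes + 1 + 1 = s + 2 * p.numNodes + 2 from rfl] at h3
    rw [BinaryTree.numNodes, labelWeight,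
      show s + 2 * (p.numNodes + r.numNodes + 1) = s + 2 * p.numNodes + 2 + 2 * r.numNodes by ring,
      ← Finset.sum_Ico_consecutive h (show s ≤ s + 2 * p.numNodes + 2 by omega) (by omega),
      Finset.sum_eq_sum_Ico_succ_bot (show s < s + 2 * p.numNodes + 2 by omega) h,
      ← Finset.sum_Ico_consecutive l (show s ≤ s + 2 * p.numNodes + 2 by omega) (by omega),
      Finset.sum_eq_sum_Ico_succ_bot (show s < s + 2 * p.numNodes + 2 by omega) l,
      Finset.sum_Ico_succ_top (show s + 1 ≤ s + 2 * p.numNodes + 1 by omega) l]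
    omega

/-- The labellings of tilings are those counted by `transfer`. -/
theorem isLabelling_iff (t : BinaryTree Unit) (c : (ℕ → ℕ) × (ℕ → ℕ)) :
    IsLabelling t 0 0 0 c ∧ c.1 (2 * t.numNodes) = 0 ↔
      IsClosedLabelling (height (DyckWord.ofTree t)) t.numNodes c.1 c.2 := by
  have hf : Follows (height (DyckWord.ofTree t)) t 0 := follows_of_eq fun x _ => by simp
  constructor
  · rintro ⟨⟨hv, h1, h2, h3⟩, h4⟩
    have hc (x : ℕ) (hx : x < 2 * t.numNodes) := hv.isClosedAt hf x x.zero_le (by omega)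
    have hl (x : ℕ) (hx : 2 * t.numNodes ≤ x) : c.2 x = 0 := h3 x (by omega)
    refine ⟨h1, fun x hx => ?_, fun x hx => (hc x hx).up, fun x hx => (hc x hx).down,
      fun x => ?_, fun x hx => ?_⟩
    · rcases hx.eq_or_lt with rfl | hx
      · exact h4
      · exact h2 x (by omega)
    · rcases lt_or_ge x (2 * t.numNodes) with hx | hx
      · exact (hc x hx).le
      · simp [hl x hx]
    · rcases lt_or_ge x (2 * t.numNodes) with hx' | hx'
      · obtain ⟨a, b, -, h5, h6, h7, h8⟩ := (hc x hx').closed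
        exact ⟨a, b, h5, h6, by omega, h8⟩
      · exact absurd (hl x hx') hx.ne'
  · intro h
    have h0 (x : ℕ) (hx : 2 * t.numNodes ≤ x) : c.2 x = 0 := by
      have := (h.le x).1
      have := h.last x hx
      omega
    refine ⟨⟨valid_of_isClosedAt (m := 0) (n := 2 * t.numNodes) hf (fun x _ hx => ?_)
      (Nat.zero_le _) (fun _ _ _ => Nat.zero_le _), h.first, fun x hx => h.last x (by omega),
      fun x hx => h0 x (by omega)⟩, h.last _ le_rfl⟩
    refine ⟨h.up x (by omega), h.down x (by omega), h.le x, ?_⟩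
    rcases (c.2 x).eq_zero_or_pos with h1 | h1
    -- `IsClosedAt` asks for an excursion even where there is no joint; the whole path will do.
    · refine ⟨0, 2 * t.numNodes, le_rfl, x.zero_le, by omega, le_rfl,
        ⟨Nat.zero_le _, ?_, fun y _ _ => ?_⟩, fun z _ _ => by omega⟩
      · rw [height_zero_right, height_of_le (by rw [semilength_ofTree])]
      · rw [height_zero_right]; exact height_nonneg _ _
    · obtain ⟨a, b, h5, h6, h7, h8⟩ := h.closed x h1
      exact ⟨a, b, a.zero_le, h5, h6, h7, h8⟩

theorem art_eq_labelWeight {t : BinaryTree Unit} {m : DyckWord} {D : Finset (Finset Box)}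
    (hD : IsCoverInclusive (DyckWord.ofTree t) m D) {c : (ℕ → ℕ) × (ℕ → ℕ)}
    (hc : IsClosedLabelling (height (DyckWord.ofTree t)) t.numNodes c.1 c.2)
    (he : Encodes (height (DyckWord.ofTree t)) D c.1 c.2) :
    art D = labelWeight c.1 c.2 t 0 := by
  have h1 := two_mul_labelWeight_add ((isLabelling_iff t c).2 hc).1.valid
  have h2 := two_mul_art_add hD (by rwa [semilength_ofTree]) he
  rw [semilength_ofTree, Finset.range_eq_Ico, Finset.range_eq_Ico] at h2
  rw [zero_add] at h1
  omega

/-- The upper path ends at height `0`, so only labellings with last height `0` matter; the indicator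
function in `transfer_zero` selects them. -/
theorem sum_tilingsWithLower (t : BinaryTree Unit) :
    ∑ D ∈ tilingsWithLower (DyckWord.ofTree t), (RatFunc.X : RatFunc ℚ) ^ art D =
      treeWeight t := by
  obtain ⟨S, hS, hsum⟩ := exists_finset_isLabelling (RatFunc.X : RatFunc ℚ) t 0 0 0 le_rfl
  have hmem (c) : c ∈ S.filter (fun c => c.1 (2 * t.numNodes) = 0) ↔
      IsClosedLabelling (height (DyckWord.ofTree t)) t.numNodes c.1 c.2 := by
    rw [Finset.mem_filter, hS, isLabelling_iff]
  have hex (D) (hD : D ∈ tilingsWithLower (DyckWord.ofTree t)) : ∃ c : (ℕ → ℕ) × (ℕ → ℕ),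
      IsClosedLabelling (height (DyckWord.ofTree t)) t.numNodes c.1 c.2 ∧
        Encodes (height (DyckWord.ofTree t)) D c.1 c.2 := by
    obtain ⟨m, hm⟩ := mem_tilingsWithLower.1 hD
    obtain ⟨h, l, h1, h2⟩ := hm.exists_encodes
    rw [semilength_ofTree] at h1
    exact ⟨(h, l), h1, h2⟩
  choose c hc hc' using hex
  rw [← transfer_zero, ← hsum]
  simp only [zero_add, mul_ite, mul_one, mul_zero]
  rw [← Finset.sum_filter]
  refine Finset.sum_bij c (fun D hD => (hmem _).2 (hc D hD)) (fun D hD D' hD' h => ?_)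
    (fun c₀ h₀ => ?_) (fun D hD => ?_)
  · exact (hc' D hD).tiling_unique (h ▸ hc' D' hD')
  · have h₀ := (hmem c₀).1 h₀
    have h₁ := h₀
    rw [← semilength_ofTree t] at h₁
    obtain ⟨m, D, hD, he⟩ := h₁.exists_tiling
    have hD' := mem_tilingsWithLower.2 ⟨m, hD⟩
    obtain ⟨h1, h2⟩ := (hc' D hD').label_unique he
    exact ⟨D, hD', Prod.ext h1 h2⟩
  · obtain ⟨m, hm⟩ := mem_tilingsWithLower.1 hD
    rw [art_eq_labelWeight hm (hc D hD) (hc' D hD)]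

end Shape
end DyckTiling

theorem mainTheorem2 (w : DyckWord) :
    ∑ D ∈ DyckTiling.tilingsWithLower w, (RatFunc.X : RatFunc ℚ) ^ DyckTiling.art D =
      ((DyckTiling.planeTree w).ramificationPoints.map fun t =>
        DyckTiling.qMultinomial t.numEdges (t.children.map fun s => s.numEdges + 1)).prod := by
  rw [← DyckWord.ofTree_toTree w, DyckTiling.sum_tilingsWithLower, ← DyckTiling.prod_vertexWeight,
    ← DyckTiling.prod_ramificationPoints]
  rfl
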